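/- Let $K$ be a field of characteristic $0$. For a group $\Gamma$, let $J(\Gamma)$ (its Jordan constant) denote the minimal integer such that every finite subgroup $G\subseteq\Gamma$ has an abelian normal subgroup $A\trianglelefteq G$ with $[G:A]\le J(\Gamma)$, with $J(\Gamma)=\infty$ if no such integer exists. Then $$J(\mathrm{GL}_2(K))\in\{60,24,12,2\}.$$ More explicitly: (i) $J(\mathrm{GL}_2(K))=60$ if and only if $-1$ is the sum of two squares in $K$ and $\sqrt5\in K$; (ii) $J(\mathrm{GL}_2(K))=24$ if and only if $-1$ is the sum of two squares in $K$, $\sqrt5\notin K$, and there exists $\zeta\in K$ such that $2\zeta^2$ is a root of unity; (iii) $J(\mathrm{GL}_2(K))=12$ if and only if $-1$ is the sum of two squares in $K$, $\sqrt5\notin K$, and for every $\zeta\in K$, $2\zeta^2$ is not a root of unity; (iv) $J(\mathrm{GL}_2(K))=2$ if and only if $-1$ is not the sum of two squares in $K$. Here one of the two squares may be $0$, and a root of unity is an element $x$ with $x^n=1$ for some integer $n\ge 1$. -/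

import Mathlib

/-- `n` is a Jordan bound for the group `Γ`: every finite subgroup of `Γ` has an abelian normal
subgroup (normal in that finite subgroup) of index at most `n`. -/
def IsJordanBound (Γ : Type*) [Group Γ] (n : ℕ) : Prop :=
  ∀ H : Subgroup Γ, Finite H →
    ∃ A : Subgroup H, A.Normal ∧ (∀ a ∈ A, ∀ b ∈ A, a * b = b * a) ∧ A.index ≤ n

/-- The Jordan constant of a group: the least Jordan bound, and `⊤` if there is no Jordan bound. -/
noncomputable def jordanConstant (Γ : Type*) [Group Γ] : ℕ∞ :=
  ⨅ (n : ℕ) (_ : IsJordanBound Γ n), (n : ℕ∞)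

/-- `-1` is a sum of two squares in `K`. -/
def NegOneIsSumOfTwoSquares (K : Type*) [Field K] : Prop :=
  ∃ x y : K, (-1 : K) = x ^ 2 + y ^ 2

/-- `x` is a root of unity (of any positive order) in `K`. -/
def IsRootOfUnity {K : Type*} [Field K] (x : K) : Prop :=
  ∃ n : ℕ, 0 < n ∧ x ^ n = 1

/-! Upper bounds. Let `G` be a finite non-abelian subgroup of `GL₂(K)`, `Z` its center and `n = [G :
Z]`. A non-scalar 2×2 matrix `g` commutes only with `K[g]`, so `Z` consists of the scalars in `G`,
and the centralizers `T` of non-central elements are abelian and partition `G \ Z`. In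
characteristic 0 an element of finite order has distinct eigenvalues, so `T` has index `f ∈ {1, 2}`
in its normalizer. With `e = [T : Z]`, counting over conjugacy classes of centralizers gives `∑ (1 -
1/e)/f = 1 - 1/n`, a version of Klein's count of poles that stays inside `G` and `K`. Its solutions
have `n ≤ 2e` for some class, so that `T` is an abelian normal subgroup of index at most 2, or else
`n = 12, 24, 60`, where the center has index `n`.

The large cases constrain `K`. For `n = 12, 60` all centralizers with `e` even are conjugate, which
makes certain determinants squares and lets two anticommuting elements be rescaled to quaternion
units. For `n = 24` the units are normalized traceless parts of elements of order 4 modulo `Z`, and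
such an element `c` has `tr² = 2 det`, so `ζ = 1 / tr c` works. Quaternion units in `M₂(K)` make
`-1` a sum of two squares. For `n = 60` an element of order 5 modulo `Z` yields `√5`. All this is
collected in `finite_linear_group_cases`.

Lower bounds. If `-1 = x² + y²`, Hamilton's quaternions map to `M₂(K)`, and stabilizers of an
octahedron or icosahedron of pure quaternions, with determinant a root of unity of bounded order,
are finite. Two non-commuting elements of order 3 force every abelian normal subgroup to be central,
so the index of the center is a lower bound. The classification leaves only 12, 24, 60, and one
element of order 4 or 5 modulo the center selects the value. -/

section MatrixTwo

/-! ### Linear algebra of 2×2 matrices: commutants, powers, anticommutation. -/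

variable {K : Type*} [Field K]

/-- The matrix `M` is a scalar matrix. -/
def IsScalarMatrix (M : Matrix (Fin 2) (Fin 2) K) : Prop := ∃ c : K, M = c • 1

theorem isScalarMatrix_iff {M : Matrix (Fin 2) (Fin 2) K} :
    IsScalarMatrix M ↔ M 0 1 = 0 ∧ M 1 0 = 0 ∧ M 0 0 = M 1 1 := by
  constructor
  · rintro ⟨c, rfl⟩
    simp
  · rintro ⟨h1, h2, h3⟩
    refine ⟨M 0 0, ?_⟩
    ext i j
    fin_cases i <;> fin_cases j <;> simp [h1, h2, h3]

theorem matrixTwo_eq_iff {R : Type*} {A B : Matrix (Fin 2) (Fin 2) R} :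
    A = B ↔ A 0 0 = B 0 0 ∧ A 0 1 = B 0 1 ∧ A 1 0 = B 1 0 ∧ A 1 1 = B 1 1 := by
  constructor
  · rintro rfl; simp
  · rintro ⟨h1, h2, h3, h4⟩
    ext i j
    fin_cases i <;> fin_cases j <;> assumption

/-- The commutant of a non-scalar 2×2 matrix is `K[g]`. The coefficient `β` is read off from a
nonzero off-diagonal entry of `g`, or from the difference of its diagonal entries when `g` is
diagonal. -/
theorem exists_eq_add_smul_of_commute {g h : Matrix (Fin 2) (Fin 2) K} (hg : ¬ IsScalarMatrix g)
    (hc : h * g = g * h) : ∃ α β : K, h = α • 1 + β • g := by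
  rw [isScalarMatrix_iff] at hg
  simp only [matrixTwo_eq_iff, Matrix.mul_apply, Fin.sum_univ_two] at hc
  obtain ⟨h1, h2, h3, h4⟩ := hc
  by_cases hb : g 0 1 = 0
  · by_cases hc : g 1 0 = 0
    · have hd : g 0 0 - g 1 1 ≠ 0 := by
        intro h; exact hg ⟨hb, hc, sub_eq_zero.mp h⟩
      refine ⟨h 0 0 - (h 0 0 - h 1 1) / (g 0 0 - g 1 1) * g 0 0,
        (h 0 0 - h 1 1) / (g 0 0 - g 1 1), ?_⟩
      simp only [matrixTwo_eq_iff]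
      simp
      refine ⟨?_, ?_, ?_⟩ <;> field_simp <;> grind
    · refine ⟨h 0 0 - h 1 0 / g 1 0 * g 0 0, h 1 0 / g 1 0, ?_⟩
      simp only [matrixTwo_eq_iff]
      simp
      refine ⟨?_, ?_, ?_⟩ <;> field_simp <;> grind
  · refine ⟨h 0 0 - h 0 1 / g 0 1 * g 0 0, h 0 1 / g 0 1, ?_⟩
    simp only [matrixTwo_eq_iff]
    simp
    refine ⟨?_, ?_, ?_⟩ <;> field_simp <;> grind

/-- Cayley–Hamilton; it reduces every power of `g` to the form `a • g + b • 1`, and for non-scalar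
`g` such a matrix is scalar only if `a = 0`. -/
theorem matrixTwo_mul_self (g : Matrix (Fin 2) (Fin 2) K) :
    g * g = g.trace • g - g.det • 1 := by
  simp only [matrixTwo_eq_iff, Matrix.mul_apply, Fin.sum_univ_two, Matrix.trace_fin_two,
    Matrix.det_fin_two]
  simp
  refine ⟨?_, ?_, ?_, ?_⟩ <;> ring

theorem IsScalarMatrix.smul_add_smul_one_iff {g : Matrix (Fin 2) (Fin 2) K}
    (hg : ¬ IsScalarMatrix g) {a b : K} : IsScalarMatrix (a • g + b • 1) ↔ a = 0 := by
  constructor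
  · rintro ⟨c, hc⟩
    by_contra ha
    refine hg ⟨a⁻¹ * (c - b), ?_⟩
    have : a • g = (c - b) • (1 : Matrix (Fin 2) (Fin 2) K) := by
      rw [sub_smul, ← hc, add_sub_cancel_right]
    rw [mul_smul, ← this, smul_smul, inv_mul_cancel₀ ha, one_smul]
  · rintro rfl
    exact ⟨b, by simp⟩

theorem trace_eq_zero_of_isScalarMatrix_sq {g : Matrix (Fin 2) (Fin 2) K}
    (hg : ¬ IsScalarMatrix g) (h : IsScalarMatrix (g * g)) : g.trace = 0 := by
  rw [matrixTwo_mul_self, sub_eq_add_neg, ← neg_smul] at h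
  exact (IsScalarMatrix.smul_add_smul_one_iff hg).mp h

theorem isScalarMatrix_sq_of_trace_eq_zero {g : Matrix (Fin 2) (Fin 2) K}
    (h : g.trace = 0) : g * g = (-g.det) • 1 := by
  rw [matrixTwo_mul_self, h]; simp

/-- A matrix whose fourth power is scalar but whose square is not satisfies `tr ^ 2 = 2 det`. -/
theorem trace_sq_of_pow_four {g : Matrix (Fin 2) (Fin 2) K}
    (h2 : ¬ IsScalarMatrix (g * g)) (h4 : IsScalarMatrix (g ^ 4)) :
    g.trace ≠ 0 ∧ g.trace ^ 2 = 2 * g.det := by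
  have ht : g.trace ≠ 0 := fun h => h2 ⟨_, isScalarMatrix_sq_of_trace_eq_zero h⟩
  have hg : ¬ IsScalarMatrix g := by
    rintro ⟨c, rfl⟩
    exact h2 ⟨c * c, by simp [smul_smul]⟩
  refine ⟨ht, ?_⟩
  have e : g ^ 4 = (g.trace * (g.trace ^ 2 - 2 * g.det)) • g
      + (-(g.trace ^ 2 * g.det) + g.det ^ 2) • 1 := by
    have h4' : g ^ 4 = (g * g) * (g * g) := by noncomm_ring
    have h2' := matrixTwo_mul_self g
    rw [h4', h2']
    simp only [sub_mul, mul_sub, smul_mul_assoc, mul_smul_comm, one_mul, mul_one, h2', smul_sub,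
      smul_smul]
    module
  rw [e, IsScalarMatrix.smul_add_smul_one_iff hg] at h4
  have := (mul_eq_zero.mp h4).resolve_left ht
  linear_combination this

/-- A non-scalar invertible matrix whose fifth power is scalar gives a square root of `5`. -/
theorem exists_sq_eq_five_of_pow_five {g : Matrix (Fin 2) (Fin 2) K}
    (h1 : ¬ IsScalarMatrix g) (hd : g.det ≠ 0) (h5 : IsScalarMatrix (g ^ 5)) :
    ∃ s : K, s ^ 2 = 5 := by
  have e : g ^ 5 = (g.trace ^ 4 - 3 * g.trace ^ 2 * g.det + g.det ^ 2) • g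
      + (-(g.trace ^ 3 * g.det) + 2 * g.trace * g.det ^ 2) • 1 := by
    have h4' : g ^ 5 = (g * g) * (g * g) * g := by noncomm_ring
    have h2' := matrixTwo_mul_self g
    rw [h4', h2']
    simp only [sub_mul, mul_sub, smul_mul_assoc, mul_smul_comm, one_mul, mul_one, h2', smul_sub,
      smul_smul]
    module
  rw [e, IsScalarMatrix.smul_add_smul_one_iff h1] at h5
  -- With `u = tr² / det`, the vanishing coefficient of `g` reads `u² - 3u + 1 = 0`, hence `(2u -
  -- 3)² = 5`.
  refine ⟨2 * g.trace ^ 2 / g.det - 3, ?_⟩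
  field_simp
  linear_combination 4 * h5

/-- The traceless elements of `K[c]` are the multiples of `c` when `c` itself is traceless and
non-scalar, and `c²` is scalar. -/
theorem isScalarMatrix_mul_of_commute_of_trace_eq_zero [CharZero K]
    {c d : Matrix (Fin 2) (Fin 2) K} (hc : ¬ IsScalarMatrix c) (hct : c.trace = 0)
    (hdt : d.trace = 0) (h : d * c = c * d) : IsScalarMatrix (c * d) := by
  obtain ⟨α, β, rfl⟩ := exists_eq_add_smul_of_commute hc h
  have hα : α = 0 := by simpa [hct] using hdt
  subst hα
  refine ⟨β * -c.det, ?_⟩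
  simp [isScalarMatrix_sq_of_trace_eq_zero hct, smul_smul]

/-- In characteristic zero a non-scalar matrix of finite order has distinct eigenvalues. -/
theorem disc_ne_zero_of_pow_eq_one [CharZero K] {g : Matrix (Fin 2) (Fin 2) K}
    (hg : ¬ IsScalarMatrix g) {m : ℕ} (hm : 0 < m) (h : g ^ m = 1) :
    g.trace ^ 2 - 4 * g.det ≠ 0 := by
  intro hd
  have hdet : g.det ≠ 0 := by
    intro h0
    have := congrArg Matrix.det h
    rw [Matrix.det_pow, h0, zero_pow hm.ne', Matrix.det_one] at this
    exact zero_ne_one this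
  have ht : g.trace ≠ 0 := by
    intro h0; apply hdet; rw [h0] at hd; simpa using hd
  -- If the discriminant vanishes, `2g - tr` squares to zero, and this is the binomial expansion of
  -- `(tr + (2g - tr))^k`. At `k = 0` the truncated exponent `k - 1` is harmless because of the
  -- factor `k`.
  have key : ∀ k : ℕ, (2 : K) ^ k • g ^ k =
      (2 * k * g.trace ^ (k - 1)) • g + (g.trace ^ k - k * g.trace ^ k) • 1 := by
    intro k
    induction k with
    | zero => simp
    | succ k ih =>
      have h2 := matrixTwo_mul_self g
      have hd' : g.det = g.trace ^ 2 / 4 := by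
        field_simp; linear_combination -hd
      rw [pow_succ, pow_succ, mul_comm _ (2 : K), mul_smul, ← smul_mul_assoc, ih]
      simp only [add_mul, smul_mul_assoc, one_mul, h2, hd', smul_add, smul_sub, smul_smul]
      rcases k with _ | k
      · simp
      · simp only [Nat.add_sub_cancel]
        push_cast
        match_scalars <;> ring
  have := key m
  rw [h] at this
  have h3 : IsScalarMatrix ((2 * m * g.trace ^ (m - 1)) • g +
      (g.trace ^ m - m * g.trace ^ m) • (1 : Matrix (Fin 2) (Fin 2) K)) := ⟨_, this.symm⟩
  rw [IsScalarMatrix.smul_add_smul_one_iff hg] at h3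
  have : (m : K) ≠ 0 := by exact_mod_cast hm.ne'
  simp_all

/-- A matrix normalizing the commutant of a non-scalar matrix `g` of finite order commutes with
`g` or anticommutes with its traceless part. -/
theorem commute_or_anticommute [CharZero K] {g u v : Matrix (Fin 2) (Fin 2) K}
    (hg : ¬ IsScalarMatrix g) (hd : g.trace ^ 2 - 4 * g.det ≠ 0)
    (huv : v * u = 1) (hc : (u * g * v) * g = g * (u * g * v)) :
    u * g = g * u ∨
      u * ((2 : K) • g - g.trace • 1) = -(((2 : K) • g - g.trace • 1) * u) := by
  obtain ⟨α, β, h⟩ := exists_eq_add_smul_of_commute hg hc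
  have htr : (u * g * v).trace = g.trace := by
    rw [Matrix.trace_mul_comm, ← mul_assoc, huv, one_mul]
  have hdet : (u * g * v).det = g.det := by
    have := congrArg Matrix.det huv
    rw [Matrix.det_mul, Matrix.det_one] at this
    rw [Matrix.det_mul, Matrix.det_mul]
    linear_combination g.det * this
  have hug : u * g = (α • 1 + β • g) * u := by
    rw [← h, mul_assoc _ v u, huv, mul_one]
  rw [h] at htr hdet
  have ht' : 2 * α + β * g.trace = g.trace := by
    simpa [mul_comm] using htr
  have hd' : α ^ 2 + α * β * g.trace + β ^ 2 * g.det = g.det := by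
    have := hdet
    simp only [Matrix.det_fin_two, Matrix.trace_fin_two, Matrix.add_apply, Matrix.smul_apply,
      smul_eq_mul, Matrix.one_apply_eq, Matrix.one_apply_ne (zero_ne_one (α := Fin 2)),
      Matrix.one_apply_ne (one_ne_zero (α := Fin 2))] at this ⊢
    linear_combination this
  have hβ : (β - 1) * (β + 1) = 0 := by
    -- The discriminant of `α + βg` is `β²` times that of `g`, while conjugation preserves it.
    have : (β ^ 2 - 1) * (g.trace ^ 2 - 4 * g.det) = 0 := by
      linear_combination (2 * α + β * g.trace + g.trace) * ht' - 4 * hd'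
    have := (mul_eq_zero.mp this).resolve_right hd
    linear_combination this
  rcases mul_eq_zero.mp hβ with hβ | hβ
  · left
    have hβ : β = 1 := by linear_combination hβ
    have hα : α = 0 := by subst hβ; simpa using ht'
    rw [hug, hα, hβ]; simp
  · right
    have hβ : β = -1 := by linear_combination hβ
    have hα : α = g.trace := by
      subst hβ
      have : 2 * (α - g.trace) = 0 := by linear_combination ht'
      simpa [sub_eq_zero] using this
    rw [mul_sub, mul_smul_comm, hug, hα, hβ]
    simp only [add_mul, sub_mul, smul_mul_assoc, one_mul, mul_smul_comm, mul_one]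
    module

/-- If `M₂(K)` contains a copy of Hamilton's quaternion units, then `-1` is a sum of two
squares. -/
theorem negOneIsSumOfTwoSquares_of_quaternion {i j : Matrix (Fin 2) (Fin 2) K}
    [CharZero K] (hi : i * i = -1) (hj : j * j = -1) (hij : i * j = -(j * i)) :
    NegOneIsSumOfTwoSquares K := by
  have solve : ∀ a b c : K, a ^ 2 + b ^ 2 + c ^ 2 = 0 → (a ≠ 0 ∨ b ≠ 0 ∨ c ≠ 0) →
      NegOneIsSumOfTwoSquares K := by
    rintro a b c h (h0 | h0 | h0)
    · exact ⟨b / a, c / a, by field_simp; linear_combination -h⟩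
    · exact ⟨a / b, c / b, by field_simp; linear_combination -h⟩
    · exact ⟨a / c, b / c, by field_simp; linear_combination -h⟩
  set k := i * j with hk
  have sq : ∀ a b c : K, (a • i + b • j + c • k) * (a • i + b • j + c • k)
      = (-(a ^ 2 + b ^ 2 + c ^ 2)) • 1 := by
    intro a b c
    have hji : j * i = - k := by rw [hij, neg_neg]
    have hik : i * k = -j := by rw [hk, ← mul_assoc, hi, neg_one_mul]
    have hki : k * i = j := by rw [hk, mul_assoc, hji, mul_neg, hik, neg_neg]
    have hjk : j * k = i := by rw [hk, ← mul_assoc, hji, hk, neg_mul, mul_assoc, hj]; simp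
    have hkj : k * j = -i := by rw [hk, mul_assoc, hj]; simp
    have hkk : k * k = -1 := by
      nth_rw 1 [hk]; rw [mul_assoc, hjk, hi]
    simp only [add_mul, mul_add, smul_mul_assoc, mul_smul_comm, hi, hj, hji, hik, hki, hjk, hkj,
      hkk, ← hk]
    module
  -- three vectors in the plane are linearly dependent
  have hdep : ∃ a b c : K, (a ≠ 0 ∨ b ≠ 0 ∨ c ≠ 0) ∧
      a * i 0 0 + b * j 0 0 + c * k 0 0 = 0 ∧ a * i 1 0 + b * j 1 0 + c * k 1 0 = 0 := by
    -- The coefficients are the cross product of the two rows formed by the first columns of `i`,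
    -- `j`, `k`. If it vanishes, a relation between `i` and `j` alone suffices.
    by_cases h : j 0 0 * k 1 0 - j 1 0 * k 0 0 = 0 ∧ k 0 0 * i 1 0 - k 1 0 * i 0 0 = 0 ∧
        i 0 0 * j 1 0 - i 1 0 * j 0 0 = 0
    · obtain ⟨h1, h2, h3⟩ := h
      by_cases hz : i 1 0 = 0 ∧ j 1 0 = 0
      · by_cases hz' : i 0 0 = 0
        · exact ⟨1, 0, 0, by simp, by simp [hz'], by simp [hz.1]⟩
        · exact ⟨-j 0 0, i 0 0, 0, by simp [hz'], by ring, by simp [hz.1, hz.2]⟩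
      · refine ⟨-j 1 0, i 1 0, 0, ?_, by linear_combination -h3, by ring⟩
        rw [not_and_or] at hz
        rcases hz with hz | hz
        · right; left; exact hz
        · left; exact neg_ne_zero.mpr hz
    · refine ⟨j 0 0 * k 1 0 - j 1 0 * k 0 0, k 0 0 * i 1 0 - k 1 0 * i 0 0,
        i 0 0 * j 1 0 - i 1 0 * j 0 0, ?_, by ring, by ring⟩
      tauto
  obtain ⟨a, b, c, hne, h0, h1⟩ := hdep
  -- A matrix with zero first column has a square with zero corner entry, whereas this square is
  -- `-(a² + b² + c²)`.
  refine solve a b c ?_ hne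
  have := congrFun (congrFun (sq a b c) 0) 0
  simp only [Matrix.mul_apply, Fin.sum_univ_two, Matrix.add_apply, Matrix.smul_apply,
    smul_eq_mul, Matrix.one_apply_eq, h0, h1] at this
  linear_combination this

end MatrixTwo

/-! ### Centralizers of non-central elements and their class equation. -/

section NoncentralCentralizers

open Subgroup

/-- The centralizers of the non-central elements of a group. -/
def NoncentralCentralizer (G : Type*) [Group G] : Type _ :=
  {T : Subgroup G // ∃ g, g ∉ center G ∧ T = centralizer {g}}

/-- Centralizers of non-central elements are abelian. -/
def CentralizersAbelian (G : Type*) [Group G] : Prop :=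
  ∀ g : G, g ∉ center G → ∀ a b : G, Commute a g → Commute b g → Commute a b

/-- Centralizers of non-central elements have index at most two in their normalizers. -/
def CentralizersIndexTwo (G : Type*) [Group G] : Prop :=
  ∀ g : G, g ∉ center G → ∀ u v : G, Commute (u * g * u⁻¹) g → Commute (v * g * v⁻¹) g →
    ¬ Commute u g → ¬ Commute v g → Commute (v * u) g

variable {G : Type*} [Group G]

namespace NoncentralCentralizer

/-- The centralizer of a non-central element. -/
def ofElement (g : G) (hg : g ∉ center G) : NoncentralCentralizer G :=
  ⟨centralizer {g}, g, hg, rfl⟩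

theorem mem_ofElement {g : G} (hg : g ∉ center G) {x : G} :
    x ∈ (ofElement g hg).1 ↔ Commute x g := by
  simp only [ofElement, mem_centralizer_singleton_iff]
  exact ⟨fun h => h, fun h => h⟩

theorem self_mem_ofElement {g : G} (hg : g ∉ center G) : g ∈ (ofElement g hg).1 :=
  (mem_ofElement hg).mpr (Commute.refl g)

theorem center_le (T : NoncentralCentralizer G) : center G ≤ T.1 := by
  obtain ⟨T, g, hg, rfl⟩ := T
  exact center_le_centralizer _

theorem exists_eq_ofElement (T : NoncentralCentralizer G) :
    ∃ (g : G) (hg : g ∉ center G), T = ofElement g hg := by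
  obtain ⟨T, g, hg, rfl⟩ := T
  exact ⟨g, hg, rfl⟩

/-- Commutation is transitive on non-central elements, so two different centralizers meet only in
the center. -/
theorem eq_ofElement (hAC : CentralizersAbelian G) {T : NoncentralCentralizer G} {h : G}
    (hh : h ∉ center G) (hT : h ∈ T.1) : T = ofElement h hh := by
  obtain ⟨g, hg, rfl⟩ := exists_eq_ofElement T
  rw [mem_ofElement] at hT
  apply Subtype.ext
  ext x
  rw [mem_ofElement, mem_ofElement]
  exact ⟨fun hx => hAC g hg x h hx hT, fun hx => hAC h hh x g hx hT.symm⟩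

theorem commute_of_mem (hAC : CentralizersAbelian G) {T : NoncentralCentralizer G} {a b : G}
    (ha : a ∈ T.1) (hb : b ∈ T.1) : Commute a b := by
  obtain ⟨g, hg, rfl⟩ := exists_eq_ofElement T
  exact hAC g hg a b ((mem_ofElement hg).mp ha) ((mem_ofElement hg).mp hb)

theorem conj_notMem_center {g : G} (x : G) (hg : g ∉ center G) : x * g * x⁻¹ ∉ center G := by
  intro h
  apply hg
  have := Normal.conj_mem inferInstance _ h x⁻¹
  simpa [mul_assoc] using this

theorem map_conj_centralizer (x g : G) :
    (centralizer {g}).map (MulAut.conj x).toMonoidHom = centralizer {x * g * x⁻¹} := by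
  ext y
  rw [Subgroup.mem_map]
  constructor
  · rintro ⟨z, hz, rfl⟩
    rw [mem_centralizer_singleton_iff] at hz ⊢
    simp only [MulEquiv.toMonoidHom_eq_coe, MonoidHom.coe_coe, MulAut.conj_apply]
    calc x * z * x⁻¹ * (x * g * x⁻¹) = x * (z * g) * x⁻¹ := by group
      _ = x * g * x⁻¹ * (x * z * x⁻¹) := by rw [hz]; group
  · intro hy
    rw [mem_centralizer_singleton_iff] at hy
    refine ⟨x⁻¹ * y * x, ?_, by simp [mul_assoc]⟩
    rw [mem_centralizer_singleton_iff]
    calc x⁻¹ * y * x * g = x⁻¹ * (y * (x * g * x⁻¹)) * x := by group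
      _ = g * (x⁻¹ * y * x) := by rw [hy]; group

/-- Conjugation; the stabilizer of `T` is its normalizer in `G`. -/
instance : MulAction G (NoncentralCentralizer G) where
  smul x T := ⟨T.1.map (MulAut.conj x).toMonoidHom, by
    obtain ⟨T, g, hg, rfl⟩ := T
    exact ⟨x * g * x⁻¹, conj_notMem_center x hg, map_conj_centralizer x g⟩⟩
  one_smul T := by
    apply Subtype.ext
    change T.1.map (MulAut.conj 1).toMonoidHom = T.1
    ext y
    simp
  mul_smul x y T := by
    apply Subtype.ext
    change T.1.map (MulAut.conj (x * y)).toMonoidHom =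
      (T.1.map (MulAut.conj y).toMonoidHom).map (MulAut.conj x).toMonoidHom
    rw [Subgroup.map_map]
    congr 1
    ext z
    simp [mul_assoc]

theorem smul_val (x : G) (T : NoncentralCentralizer G) :
    (x • T).1 = T.1.map (MulAut.conj x).toMonoidHom := rfl

theorem smul_ofElement (x : G) {g : G} (hg : g ∉ center G) :
    x • ofElement g hg = ofElement (x * g * x⁻¹) (conj_notMem_center x hg) :=
  Subtype.ext (map_conj_centralizer x g)

theorem conj_mem_smul {x g : G} {T : NoncentralCentralizer G} (h : g ∈ T.1) :
    x * g * x⁻¹ ∈ (x • T).1 := by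
  rw [smul_val, Subgroup.mem_map]
  exact ⟨g, h, by simp⟩

theorem smul_eq_iff (hAC : CentralizersAbelian G) (x : G) {g : G} (hg : g ∉ center G) :
    x • ofElement g hg = ofElement g hg ↔ Commute (x * g * x⁻¹) g := by
  constructor
  · intro h
    have := conj_mem_smul (x := x) (self_mem_ofElement hg)
    rwa [h, mem_ofElement] at this
  · intro h
    rw [smul_ofElement]
    exact (eq_ofElement hAC _ ((mem_ofElement hg).mpr h)).symm

theorem smul_eq_of_mem {x : G} {T : NoncentralCentralizer G} (h : x ∈ T.1) : x • T = T := by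
  obtain ⟨g, hg, rfl⟩ := exists_eq_ofElement T
  rw [mem_ofElement] at h
  rw [smul_ofElement]
  apply Subtype.ext
  simp [ofElement, h.eq]

/-- The order of a centralizer modulo the center. -/
noncomputable def order (T : NoncentralCentralizer G) : ℕ := (center G).relIndex T.1

/-- The index of a centralizer in its normalizer. -/
noncomputable def indexNormalizer (T : NoncentralCentralizer G) : ℕ :=
  T.1.relIndex (MulAction.stabilizer G T)

theorem le_stabilizer (T : NoncentralCentralizer G) : T.1 ≤ MulAction.stabilizer G T :=
  fun _ h => smul_eq_of_mem h

/-- The index is multiplicative along the chain: center, `T`, normalizer of `T`, `G`. -/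
theorem order_mul_index (T : NoncentralCentralizer G) :
    T.order * T.indexNormalizer * (MulAction.stabilizer G T).index = (center G).index := by
  rw [order, indexNormalizer, relIndex_mul_relIndex _ _ _ T.center_le T.le_stabilizer,
    relIndex_mul_index (T.center_le.trans T.le_stabilizer)]

theorem order_smul (x : G) (T : NoncentralCentralizer G) : (x • T).order = T.order := by
  have h : (center G).map (MulAut.conj x).toMonoidHom = center G := by
    ext y
    rw [Subgroup.mem_map]
    constructor
    · rintro ⟨z, hz, rfl⟩
      exact Normal.conj_mem inferInstance _ hz x
    · intro hy
      exact ⟨x⁻¹ * y * x⁻¹⁻¹, Normal.conj_mem inferInstance _ hy x⁻¹, by simp [mul_assoc]⟩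
  rw [order, order, smul_val]
  nth_rw 1 [← h]
  exact relIndex_map_map_of_injective _ _ (MulAut.conj x).injective

theorem pow_order_mem {T : NoncentralCentralizer G} {g : G} (hg : g ∈ T.1) :
    g ^ T.order ∈ center G := by
  have := Subgroup.pow_index_mem ((center G).subgroupOf T.1) ⟨g, hg⟩
  rw [mem_subgroupOf] at this
  exact this

/-- Two is a divisor of the order of a centralizer of an involution modulo the center. -/
theorem even_order_ofElement [Finite G] {u : G} (hu : u ∉ center G) (hu2 : u ^ 2 ∈ center G) :
    Even (ofElement u hu).order := by
  rw [even_iff_two_dvd]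
  have hu' : u ∈ (ofElement u hu).1 := self_mem_ofElement hu
  let N := (center G).subgroupOf (ofElement u hu).1
  let q : (ofElement u hu).1 ⧸ N := QuotientGroup.mk ⟨u, hu'⟩
  have hq : orderOf q = 2 := by
    apply orderOf_eq_prime
    · rw [← QuotientGroup.mk_pow, QuotientGroup.eq_one_iff]
      exact hu2
    · intro h
      rw [QuotientGroup.eq_one_iff] at h
      exact hu h
  have := orderOf_dvd_natCard q
  rwa [hq] at this

theorem two_le_order [Finite G] (T : NoncentralCentralizer G) : 2 ≤ T.order := by
  have h0 : T.order ≠ 0 := by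
    unfold order relIndex
    exact index_ne_zero_of_finite
  have h1 : T.order ≠ 1 := by
    intro h
    obtain ⟨g, hg, rfl⟩ := exists_eq_ofElement T
    exact hg (by simpa [h] using pow_order_mem (self_mem_ofElement hg))
  omega

/-- Two elements of the normalizer outside `T` have their product in `T`. -/
theorem indexNormalizer_eq (hAC : CentralizersAbelian G) (hN : CentralizersIndexTwo G)
    (T : NoncentralCentralizer G) : T.indexNormalizer = 1 ∨ T.indexNormalizer = 2 := by
  have : T.indexNormalizer ∣ 2 := by
    rw [indexNormalizer, relIndex_dvd_two_iff]
    obtain ⟨g, hg, rfl⟩ := exists_eq_ofElement T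
    by_cases h : ∃ a ∈ MulAction.stabilizer G (ofElement g hg), ¬ Commute a g
    · obtain ⟨a, ha, hag⟩ := h
      refine ⟨a, ha, fun b hb => ?_⟩
      rw [MulAction.mem_stabilizer_iff, smul_eq_iff hAC] at ha hb
      rw [mem_ofElement, mem_ofElement]
      by_cases hbg : Commute b g
      · exact Or.inr hbg
      · exact Or.inl (hN g hg a b ha hb hag hbg)
    · push Not at h
      refine ⟨1, one_mem _, fun b hb => Or.inr ((mem_ofElement hg).mpr (h b hb))⟩
  exact (Nat.dvd_prime Nat.prime_two).mp this

theorem exists_normalizing (hAC : CentralizersAbelian G) {g : G} (hg : g ∉ center G)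
    (h : (ofElement g hg).indexNormalizer = 2) :
    ∃ u, Commute (u * g * u⁻¹) g ∧ ¬ Commute u g := by
  by_contra! hc
  have : (ofElement g hg).indexNormalizer = 1 := by
    rw [indexNormalizer, relIndex_eq_one]
    intro u hu
    rw [MulAction.mem_stabilizer_iff, smul_eq_iff hAC] at hu
    exact (mem_ofElement hg).mpr (hc u hu)
  omega

section Counting

variable [Finite G]

instance : Finite (NoncentralCentralizer G) := by
  unfold NoncentralCentralizer; infer_instance

/-- The non-central parts of the centralizers of non-central elements partition the non-central
part of the group. -/
theorem card_eq_sum (hAC : CentralizersAbelian G) [Fintype (NoncentralCentralizer G)] :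
    (Nat.card G : ℚ) - Nat.card (center G) =
      ∑ T : NoncentralCentralizer G, ((Nat.card T.1 : ℚ) - Nat.card (center G)) := by
  classical
  have := Fintype.ofFinite G
  let S : Finset G := Finset.univ.filter (fun g => g ∉ center G)
  -- Each non-central element is sent to its centralizer and `S` is counted by fibers; the value
  -- `none` is taken only on the center, outside `S`.
  let C : G → Option (NoncentralCentralizer G) := fun g =>
    if hg : g ∉ center G then some (ofElement g hg) else none
  have hsub : ∀ T : Subgroup G, center G ≤ T →
      ((Finset.univ.filter (fun g => g ∉ center G ∧ g ∈ T)).card : ℚ) =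
        (Nat.card T : ℚ) - Nat.card (center G) := by
    intro T hT
    have h1 : Nat.card T = (Finset.univ.filter (fun g => g ∈ T)).card := by
      rw [Nat.card_eq_fintype_card, Fintype.card_subtype]
    have h2 : Nat.card (center G) = (Finset.univ.filter (fun g => g ∈ center G)).card := by
      rw [Nat.card_eq_fintype_card, Fintype.card_subtype]
    have h3 := Finset.card_filter_add_card_filter_not (s := Finset.univ.filter (fun g => g ∈ T))
      (fun g => g ∈ center G)
    rw [Finset.filter_filter, Finset.filter_filter] at h3
    have h4 : (Finset.univ.filter (fun g => g ∈ T ∧ g ∈ center G)) =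
        Finset.univ.filter (fun g => g ∈ center G) :=
      Finset.filter_congr fun g _ => ⟨fun h => h.2, fun h => ⟨hT h, h⟩⟩
    have h5 : (Finset.univ.filter (fun g => g ∉ center G ∧ g ∈ T)) =
        Finset.univ.filter (fun g => g ∈ T ∧ g ∉ center G) :=
      Finset.filter_congr fun g _ => and_comm
    rw [h4] at h3
    rw [h1, h2, h5, ← h3]
    push_cast; ring
  have hS : (S.card : ℚ) = (Nat.card G : ℚ) - Nat.card (center G) := by
    have := hsub ⊤ le_top
    simpa [S] using this
  rw [← hS, Finset.card_eq_sum_card_fiberwise (f := C) (s := S)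
    (t := Finset.univ.image some)]
  · rw [Finset.sum_image (by intro a _ b _ h; exact Option.some_injective _ h)]
    push_cast
    refine Finset.sum_congr rfl fun T _ => ?_
    rw [← hsub T.1 T.center_le, Finset.filter_filter]
    congr 2
    refine Finset.filter_congr fun g _ => and_congr_right fun hg => ?_
    simp only [C, dif_pos hg, Option.some_inj]
    constructor
    · rintro rfl
      exact self_mem_ofElement hg
    · intro h
      exact (eq_ofElement hAC hg h).symm
  · intro g hg
    have hg' : g ∉ center G := by simpa [S] using hg
    simp [C, hg']

open MulAction in
/-- The class equation for the centralizers of non-central elements. -/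
theorem class_equation (hAC : CentralizersAbelian G)
    [Fintype (orbitRel.Quotient G (NoncentralCentralizer G))] :
    ∑ ω : orbitRel.Quotient G (NoncentralCentralizer G),
      (1 - 1 / (ω.out.order : ℚ)) / ω.out.indexNormalizer = 1 - 1 / ((center G).index : ℚ) := by
  classical
  have := Fintype.ofFinite (NoncentralCentralizer G)
  have hz : (Nat.card (center G) : ℚ) ≠ 0 := by exact_mod_cast Nat.card_pos.ne'
  have hn : ((center G).index : ℚ) ≠ 0 := by exact_mod_cast index_ne_zero_of_finite
  have hG : (Nat.card G : ℚ) = Nat.card (center G) * (center G).index := by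
    exact_mod_cast (card_mul_index (center G)).symm
  have hT : ∀ T : NoncentralCentralizer G,
      (Nat.card T.1 : ℚ) = Nat.card (center G) * T.order := by
    intro T
    have := relIndex_mul_relIndex ⊥ (center G) T.1 bot_le T.center_le
    rw [relIndex_bot_left, relIndex_bot_left] at this
    rw [order]
    exact_mod_cast this.symm
  have h := card_eq_sum hAC (G := G)
  simp only [hG, hT] at h
  have h' : ((center G).index : ℚ) - 1 = ∑ T : NoncentralCentralizer G, ((T.order : ℚ) - 1) := by
    have h1 : (Nat.card (center G) : ℚ) * ((center G).index - 1) =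
        Nat.card (center G) * ∑ T : NoncentralCentralizer G, ((T.order : ℚ) - 1) := by
      rw [Finset.mul_sum, mul_sub, mul_one, h]
      exact Finset.sum_congr rfl fun T _ => by ring
    exact mul_left_cancel₀ hz h1
  rw [← Finset.sum_fiberwise (g := fun T => (Quotient.mk _ T :
    orbitRel.Quotient G (NoncentralCentralizer G)))] at h'
  -- `order` is constant on an orbit, whose length is `[G : N(T)] = n / (e f)`, so the orbit
  -- contributes `n (1 - 1/e) / f`.
  have h2 : ∀ ω : orbitRel.Quotient G (NoncentralCentralizer G),
      ∑ T with (Quotient.mk _ T : orbitRel.Quotient G (NoncentralCentralizer G)) = ω,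
        ((T.order : ℚ) - 1) =
      (center G).index * ((1 - 1 / (ω.out.order : ℚ)) / ω.out.indexNormalizer) := by
    intro ω
    have hmem : ∀ T : NoncentralCentralizer G,
        (Quotient.mk _ T : orbitRel.Quotient G (NoncentralCentralizer G)) = ω ↔
          T ∈ orbit G ω.out := by
      intro T
      nth_rw 1 [← Quotient.out_eq ω]
      exact Quotient.eq
    have hconst : ∀ T ∈ Finset.univ.filter (fun T => (Quotient.mk _ T :
        orbitRel.Quotient G (NoncentralCentralizer G)) = ω),
        (T.order : ℚ) - 1 = ω.out.order - 1 := by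
      intro T hT
      obtain ⟨x, rfl⟩ := (hmem T).mp (Finset.mem_filter.mp hT).2
      simp only [order_smul]
    rw [Finset.sum_congr rfl hconst, Finset.sum_const, nsmul_eq_mul]
    have hcard : (Finset.univ.filter (fun T => (Quotient.mk _ T :
        orbitRel.Quotient G (NoncentralCentralizer G)) = ω)).card =
        (stabilizer G ω.out).index := by
      rw [index_stabilizer, Set.ncard_eq_toFinset_card']
      congr 1
      ext T
      simp [hmem]
    rw [hcard]
    have h3 : (ω.out.order : ℚ) * ω.out.indexNormalizer * (stabilizer G ω.out).index =
        (center G).index := by exact_mod_cast ω.out.order_mul_index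
    rw [← h3] at hn ⊢
    have h4 := left_ne_zero_of_mul (left_ne_zero_of_mul hn)
    have h5 := right_ne_zero_of_mul (left_ne_zero_of_mul hn)
    field_simp
  simp only [h2] at h'
  rw [← Finset.mul_sum] at h'
  apply mul_left_cancel₀ hn
  rw [← h']
  field_simp

end Counting

end NoncentralCentralizer

end NoncentralCentralizers

/-! ### Integer solutions of the class equation. -/

section Arithmetic

/-- The solutions of `1 / a + 1 / b + 1 / c = 1 + 2 / n` in integers `2 ≤ a ≤ b ≤ c`. -/
theorem sum_three_inv_eq {a b c n : ℕ} (ha : 2 ≤ a) (hab : a ≤ b) (hbc : b ≤ c) (hn : 0 < n)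
    (h : (1 / a + 1 / b + 1 / c : ℚ) = 1 + 2 / n) :
    n = 2 * c ∨ (a = 2 ∧ b = 3 ∧ c = 3 ∧ n = 12) ∨ (a = 2 ∧ b = 3 ∧ c = 4 ∧ n = 24) ∨
      (a = 2 ∧ b = 3 ∧ c = 5 ∧ n = 60) := by
  have inv_le : ∀ {x y : ℕ}, 0 < x → x ≤ y → (1 / y : ℚ) ≤ 1 / x := fun hx hxy =>
    one_div_le_one_div_of_le (by exact_mod_cast hx) (by exact_mod_cast hxy)
  -- The right side exceeds 1. This excludes `a ≥ 3`, then `b ≥ 4`, and for `b = 3` also `c ≥ 6`,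
  -- since 1/3 + 1/3 + 1/3, 1/2 + 1/4 + 1/4 and 1/2 + 1/3 + 1/6 all equal 1.
  have ha2 : a = 2 := by
    by_contra h2
    have h3 : 3 ≤ a := by omega
    have := inv_le (by norm_num) h3
    have := inv_le (by norm_num) (h3.trans hab)
    have := inv_le (by norm_num) ((h3.trans hab).trans hbc)
    norm_num at *
    have hn' : (0 : ℚ) < 2 / n := by positivity
    linarith
  subst ha2
  have hb3 : b ≤ 3 := by
    by_contra h2
    have h3 : 4 ≤ b := by omega
    have := inv_le (by norm_num) h3
    have := inv_le (by norm_num) (h3.trans hbc)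
    norm_num at *
    have hn' : (0 : ℚ) < 2 / n := by positivity
    linarith
  have hc0 : (c : ℚ) ≠ 0 := by
    have : 0 < c := by omega
    exact_mod_cast this.ne'
  have hn0 : (n : ℚ) ≠ 0 := by exact_mod_cast hn.ne'
  obtain rfl | rfl : b = 2 ∨ b = 3 := by omega
  · left
    have : (n : ℚ) = 2 * c := by
      field_simp at h
      push_cast at h
      linarith
    exact_mod_cast this
  · right
    have hc5 : c ≤ 5 := by
      by_contra h2
      have := inv_le (by norm_num) (show 6 ≤ c by omega)
      norm_num at *
      have hn' : (0 : ℚ) < 2 / n := by positivity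
      linarith
    have hn2 : ∀ {m : ℕ}, (2 / n : ℚ) = 2 / m → n = m := by
      intro m hm
      have hm0 : (m : ℚ) ≠ 0 := by
        rintro h0
        rw [h0] at hm
        norm_num at hm
        exact hn0 (by exact_mod_cast hm)
      field_simp at hm
      exact_mod_cast hm.symm
    obtain rfl | rfl | rfl : c = 3 ∨ c = 4 ∨ c = 5 := by omega
    · exact Or.inl ⟨rfl, rfl, rfl, hn2 (by norm_num at *; linarith)⟩
    · exact Or.inr (Or.inl ⟨rfl, rfl, rfl, hn2 (by norm_num at *; linarith)⟩)
    · exact Or.inr (Or.inr ⟨rfl, rfl, rfl, hn2 (by norm_num at *; linarith)⟩)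

/-- The solutions of `1 / a + 1 / (2 * b) = 1 / n + 1 / 2`. -/
theorem sum_two_inv_eq {a b n : ℕ} (ha : 2 ≤ a) (hb : 2 ≤ b) (hn : 0 < n)
    (h : (1 / a + 1 / (2 * b) : ℚ) = 1 / n + 1 / 2) :
    n = 2 * b ∨ (a = 3 ∧ b = 2 ∧ n = 12) := by
  have inv_le : ∀ {x y : ℕ}, 0 < x → x ≤ y → (1 / y : ℚ) ≤ 1 / x := fun hx hxy =>
    one_div_le_one_div_of_le (by exact_mod_cast hx) (by exact_mod_cast hxy)
  have hb0 : (b : ℚ) ≠ 0 := by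
    have : 0 < b := by omega
    exact_mod_cast this.ne'
  have hn0 : (n : ℚ) ≠ 0 := by exact_mod_cast hn.ne'
  have e : (1 / (2 * b) : ℚ) = 1 / b / 2 := by field_simp
  rw [e] at h
  have hb2 := inv_le (by norm_num) hb
  have ha3 : a ≤ 3 := by
    by_contra h2
    have := inv_le (by norm_num) (show 4 ≤ a by omega)
    norm_num at *
    have hn' : (0 : ℚ) < (n : ℚ)⁻¹ := by positivity
    linarith
  obtain rfl | rfl : a = 2 ∨ a = 3 := by omega
  · left
    have : (n : ℚ) = 2 * b := by
      field_simp at h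
      push_cast at h
      linarith
    exact_mod_cast this
  · right
    have hb2' : b ≤ 2 := by
      by_contra h2
      have := inv_le (by norm_num) (show 3 ≤ b by omega)
      norm_num at *
      have hn' : (0 : ℚ) < (n : ℚ)⁻¹ := by positivity
      linarith
    obtain rfl : b = 2 := by omega
    refine ⟨rfl, rfl, ?_⟩
    have : (n : ℚ) = 12 := by
      field_simp at h
      norm_num at h
      linarith
    exact_mod_cast this

/-- The numerical solutions of the class equation. -/
theorem class_equation_solutions {Ω : Type*} [Fintype Ω] (e f : Ω → ℕ) {n : ℕ} (hn : 2 ≤ n)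
    (he : ∀ ω, 2 ≤ e ω) (hf : ∀ ω, f ω = 1 ∨ f ω = 2) (hdvd : ∀ ω, e ω * f ω ∣ n)
    (h : ∑ ω, (1 - 1 / (e ω : ℚ)) / f ω = 1 - 1 / (n : ℚ)) :
    (∃ ω, n ≤ 2 * e ω) ∨
    (n = 12 ∧ (∀ ω, e ω = 2 ∨ e ω = 3) ∧
      ∃ ω, e ω = 2 ∧ f ω = 2 ∧ ∀ ω', Even (e ω') → ω' = ω) ∨
    (n = 24 ∧ ∃ ω, e ω = 4 ∧ f ω = 2) ∨
    (n = 60 ∧ (∃ ω, e ω = 5) ∧ ∃ ω, e ω = 2 ∧ f ω = 2 ∧ ∀ ω', Even (e ω') → ω' = ω) := by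
  classical
  have hn0 : (0 : ℚ) < 1 / n := by
    have : (0 : ℚ) < n := by exact_mod_cast (by omega : 0 < n)
    positivity
  have hle : ∀ ω, (1 / (e ω) : ℚ) ≤ 1 / 2 := fun ω =>
    one_div_le_one_div_of_le (by norm_num) (by exact_mod_cast he ω)
  -- `e ≥ 2` and `f ≤ 2` bound each term below by `(1/2)/2`; as the total is less than 1, there are
  -- at most three classes.
  have hterm : ∀ ω, (1 / 4 : ℚ) ≤ (1 - 1 / (e ω : ℚ)) / f ω := by
    intro ω
    have := hle ω
    rcases hf ω with h1 | h1 <;> rw [h1] <;> push_cast <;> linarith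
  have hcard : Fintype.card Ω ≤ 3 := by
    by_contra hc
    have h4 : (4 : ℚ) ≤ Fintype.card Ω := by exact_mod_cast (by omega : 4 ≤ Fintype.card Ω)
    have := Finset.sum_le_sum (s := Finset.univ) fun ω (_ : ω ∈ Finset.univ) => hterm ω
    rw [h, Finset.sum_const, nsmul_eq_mul, Finset.card_univ] at this
    linarith
  have hinv : ∀ ω, 1 / (n : ℚ) ≤ 1 / (e ω * f ω) := by
    intro ω
    have h1 := Nat.le_of_dvd (by omega) (hdvd ω)
    have h2 : 0 < e ω * f ω := Nat.pos_of_dvd_of_pos (hdvd ω) (by omega)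
    apply one_div_le_one_div_of_le
    · exact_mod_cast h2
    · exact_mod_cast h1
  obtain h0 | h1 | h2 | h3 : (Finset.univ : Finset Ω).card = 0 ∨ (Finset.univ : Finset Ω).card = 1 ∨
      (Finset.univ : Finset Ω).card = 2 ∨ (Finset.univ : Finset Ω).card = 3 := by
    rw [Finset.card_univ]; omega
  · rw [Finset.card_eq_zero] at h0
    rw [h0, Finset.sum_empty] at h
    have : (1 / n : ℚ) ≤ 1 / 2 :=
      one_div_le_one_div_of_le (by norm_num) (by exact_mod_cast hn)
    linarith
  · obtain ⟨a, ha⟩ := Finset.card_eq_one.mp h1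
    rw [ha, Finset.sum_singleton] at h
    left
    refine ⟨a, ?_⟩
    rcases hf a with h1 | h1 <;> rw [h1] at h
    · have : (n : ℚ) = e a := by
        have : (1 / n : ℚ) = 1 / e a := by push_cast at h; linarith
        rw [one_div, one_div] at this
        exact inv_injective this
      have : n = e a := by exact_mod_cast this
      omega
    · exfalso
      have h3 : (1 / n : ℚ) ≤ 1 / 2 :=
        one_div_le_one_div_of_le (by norm_num) (by exact_mod_cast hn)
      have h4 : (0 : ℚ) < 1 / e a := by
        have : (0 : ℚ) < e a := by exact_mod_cast (by have := he a; omega : 0 < e a)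
        positivity
      push_cast at h
      linarith
  · obtain ⟨a, b, hab, hu⟩ := Finset.card_eq_two.mp h2
    rw [hu, Finset.sum_pair hab] at h
    have hall : ∀ ω, ω = a ∨ ω = b := fun ω => by
      have := Finset.mem_univ ω
      rw [hu] at this
      simpa using this
    have key : ∀ a b : Ω, (∀ ω, ω = a ∨ ω = b) → f a = 1 → f b = 2 →
        (1 - 1 / (e a : ℚ)) / f a + (1 - 1 / (e b : ℚ)) / f b = 1 - 1 / (n : ℚ) →
        (∃ ω, n ≤ 2 * e ω) ∨ (n = 12 ∧ (∀ ω, e ω = 2 ∨ e ω = 3) ∧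
          ∃ ω, e ω = 2 ∧ f ω = 2 ∧ ∀ ω', Even (e ω') → ω' = ω) := by
      intro a b hall ha hb h
      have := sum_two_inv_eq (he a) (he b) (by omega : 0 < n) (by
        rw [ha, hb] at h
        have e1 : (1 / (2 * e b) : ℚ) = 1 / e b / 2 := by rw [mul_comm, div_mul_eq_div_div]
        rw [e1]
        push_cast at h
        linarith)
      rcases this with h3 | ⟨h3, h4, h5⟩
      · exact Or.inl ⟨b, h3.le⟩
      · refine Or.inr ⟨h5, ?_, b, h4, hb, ?_⟩
        · intro ω
          rcases hall ω with rfl | rfl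
          · exact Or.inr h3
          · exact Or.inl h4
        · intro ω hω
          rcases hall ω with rfl | rfl
          · rw [h3] at hω
            exact absurd hω (by decide)
          · rfl
    rcases hf a with ha | ha <;> rcases hf b with hb | hb
    · exfalso
      have h3 := hle a
      have h4 := hle b
      rw [ha, hb] at h
      push_cast at h
      linarith
    · rcases key a b hall ha hb h with h | h
      · exact Or.inl h
      · exact Or.inr (Or.inl h)
    · rcases key b a (fun ω => (hall ω).symm) hb ha (by rw [add_comm]; exact h) with h | h
      · exact Or.inl h
      · exact Or.inr (Or.inl h)
    · exfalso
      -- Here `1/n` would equal `1/(2e a) + 1/(2e b)`, but each summand is already at least `1/n`.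
      have h3 := hinv a
      have h4 := hinv b
      rw [ha, div_mul_eq_div_div] at h3
      rw [hb, div_mul_eq_div_div] at h4
      rw [ha, hb] at h
      push_cast at h h3 h4
      linarith
  · obtain ⟨a, b, c, hab, hac, hbc, hu⟩ := Finset.card_eq_three.mp h3
    rw [hu, Finset.sum_insert (by simp [hab, hac]), Finset.sum_pair hbc] at h
    have hall : ∀ ω, ω = a ∨ ω = b ∨ ω = c := fun ω => by
      have := Finset.mem_univ ω
      rw [hu] at this
      simpa using this
    -- A term with `f = 1` is at least 1/2 and the other two at least 1/4 each, too much for a total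
    -- below 1.
    have hf2 : f a = 2 ∧ f b = 2 ∧ f c = 2 := by
      have h3 := hle a
      have h4 := hle b
      have h5 := hle c
      have h6 := hterm a
      have h7 := hterm b
      have h8 := hterm c
      refine ⟨?_, ?_, ?_⟩
      · refine (hf a).resolve_left fun h' => ?_
        rw [h', Nat.cast_one, div_one] at h
        linarith
      · refine (hf b).resolve_left fun h' => ?_
        rw [h', Nat.cast_one, div_one] at h
        linarith
      · refine (hf c).resolve_left fun h' => ?_
        rw [h', Nat.cast_one, div_one] at h
        linarith
    obtain ⟨fa, fb, fc⟩ := hf2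
    have hsum : (1 / e a + 1 / e b + 1 / e c : ℚ) = 1 + 2 / n := by
      rw [fa, fb, fc] at h
      have e1 : (2 / n : ℚ) = 2 * (1 / n) := by ring
      rw [e1]
      push_cast at h
      linarith
    have key : ∀ a b c : Ω, (∀ ω, ω = a ∨ ω = b ∨ ω = c) → f a = 2 → f c = 2 →
        e a ≤ e b → e b ≤ e c → (1 / e a + 1 / e b + 1 / e c : ℚ) = 1 + 2 / n →
        (∃ ω, n ≤ 2 * e ω) ∨
        (n = 12 ∧ (∀ ω, e ω = 2 ∨ e ω = 3) ∧
          ∃ ω, e ω = 2 ∧ f ω = 2 ∧ ∀ ω', Even (e ω') → ω' = ω) ∨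
        (n = 24 ∧ ∃ ω, e ω = 4 ∧ f ω = 2) ∨
        (n = 60 ∧ (∃ ω, e ω = 5) ∧
          ∃ ω, e ω = 2 ∧ f ω = 2 ∧ ∀ ω', Even (e ω') → ω' = ω) := by
      intro a b c hall fa fc hab hbc hsum
      rcases sum_three_inv_eq (he a) hab hbc (by omega) hsum with h | ⟨ha, hb, hc, hn⟩ |
        ⟨ha, hb, hc, hn⟩ | ⟨ha, hb, hc, hn⟩
      · exact Or.inl ⟨c, h.le⟩
      · refine Or.inr (Or.inl ⟨hn, fun ω => ?_, a, ha, fa, fun ω hω => ?_⟩)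
        · rcases hall ω with rfl | rfl | rfl <;> omega
        · rcases hall ω with rfl | rfl | rfl
          · rfl
          · rw [hb] at hω; exact absurd hω (by decide)
          · rw [hc] at hω; exact absurd hω (by decide)
      · exact Or.inr (Or.inr (Or.inl ⟨hn, c, hc, fc⟩))
      · refine Or.inr (Or.inr (Or.inr ⟨hn, ⟨c, hc⟩, a, ha, fa, fun ω hω => ?_⟩))
        rcases hall ω with rfl | rfl | rfl
        · rfl
        · rw [hb] at hω; exact absurd hω (by decide)
        · rw [hc] at hω; exact absurd hω (by decide)
    rcases le_total (e a) (e b) with h1 | h1 <;> rcases le_total (e b) (e c) with h2 | h2 <;>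
      rcases le_total (e a) (e c) with h3 | h3
    · exact key a b c hall fa fc h1 h2 hsum
    · exact key a b c hall fa fc h1 h2 hsum
    · exact key a c b (fun ω => by have := hall ω; tauto) fa fb h3 h2 (by rw [← hsum]; ring)
    · exact key c a b (fun ω => by have := hall ω; tauto) fc fb h3 h1 (by rw [← hsum]; ring)
    · exact key b a c (fun ω => by have := hall ω; tauto) fb fc h1 h3 (by rw [← hsum]; ring)
    · exact key b c a (fun ω => by have := hall ω; tauto) fb fa h2 h3 (by rw [← hsum]; ring)
    · exact key c b a (fun ω => by have := hall ω; tauto) fc fa h2 h1 (by rw [← hsum]; ring)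
    · exact key c b a (fun ω => by have := hall ω; tauto) fc fa h2 h1 (by rw [← hsum]; ring)

end Arithmetic

/-! ### Finite non-abelian linear groups and what they force on the field. -/

section FiniteLinearGroups

open Subgroup

namespace NoncentralCentralizer

variable {G : Type*} [Group G]

open MulAction in
/-- The possible configurations of centralizers of non-central elements. -/
theorem configurations [Finite G] (hG : ¬ ∀ a b : G, Commute a b) (hAC : CentralizersAbelian G)
    (hN : CentralizersIndexTwo G) :
    (∃ T : NoncentralCentralizer G, T.1.index ≤ 2) ∨
    ((center G).index = 12 ∧
      (∀ T : NoncentralCentralizer G, T.order = 2 ∨ T.order = 3) ∧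
      ∃ T : NoncentralCentralizer G, T.order = 2 ∧ T.indexNormalizer = 2 ∧
        ∀ T' : NoncentralCentralizer G, Even T'.order → T' ∈ orbit G T) ∨
    ((center G).index = 24 ∧
      ∃ T : NoncentralCentralizer G, T.order = 4 ∧ T.indexNormalizer = 2) ∨
    ((center G).index = 60 ∧ (∃ T : NoncentralCentralizer G, T.order = 5) ∧
      ∃ T : NoncentralCentralizer G, T.order = 2 ∧ T.indexNormalizer = 2 ∧
        ∀ T' : NoncentralCentralizer G, Even T'.order → T' ∈ orbit G T) := by
  classical
  have := Fintype.ofFinite (orbitRel.Quotient G (NoncentralCentralizer G))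
  have hrel : ∀ T : NoncentralCentralizer G,
      T ∈ orbit G (Quotient.mk _ T : orbitRel.Quotient G (NoncentralCentralizer G)).out := by
    intro T
    have := Quotient.out_eq (Quotient.mk _ T : orbitRel.Quotient G (NoncentralCentralizer G))
    exact Quotient.exact this.symm
  have horder : ∀ T : NoncentralCentralizer G,
      (Quotient.mk _ T : orbitRel.Quotient G (NoncentralCentralizer G)).out.order = T.order := by
    intro T
    obtain ⟨x, hx⟩ := hrel T
    nth_rw 2 [← hx]
    exact (order_smul x _).symm
  have hn : 2 ≤ (center G).index := by
    have h0 : (center G).index ≠ 0 := index_ne_zero_of_finite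
    have h1 : (center G).index ≠ 1 := by
      intro h
      rw [index_eq_one] at h
      exact hG fun a b => (mem_center_iff.mp (h ▸ mem_top a) b).symm
    omega
  have key := class_equation_solutions
    (fun ω : orbitRel.Quotient G (NoncentralCentralizer G) => ω.out.order)
    (fun ω => ω.out.indexNormalizer) hn (fun ω => two_le_order _)
    (fun ω => indexNormalizer_eq hAC hN _) (fun ω => ⟨_, (order_mul_index ω.out).symm⟩)
    (class_equation hAC)
  have htrans : ∀ ω : orbitRel.Quotient G (NoncentralCentralizer G),
      (∀ ω' : orbitRel.Quotient G (NoncentralCentralizer G), Even ω'.out.order → ω' = ω) →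
      ∀ T' : NoncentralCentralizer G, Even T'.order → T' ∈ orbit G ω.out := by
    intro ω hω T' hT'
    rw [← horder] at hT'
    have := hrel T'
    rwa [hω _ hT'] at this
  rcases key with ⟨ω, h⟩ | ⟨h, h23, ω, h2, hf, hω⟩ | ⟨h, ω, h4, hf⟩ | ⟨h, ⟨ω', h5⟩, ω, h2, hf, hω⟩
  · left
    refine ⟨ω.out, ?_⟩
    have h1 : ω.out.order * ω.out.1.index = (center G).index :=
      relIndex_mul_index ω.out.center_le
    have h2 := two_le_order ω.out
    rw [← h1, mul_comm 2] at h
    exact Nat.le_of_mul_le_mul_left h (by omega)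
  · refine Or.inr (Or.inl ⟨h, fun T => ?_, ω.out, h2, hf, htrans ω hω⟩)
    rw [← horder]
    exact h23 _
  · exact Or.inr (Or.inr (Or.inl ⟨h, ω.out, h4, hf⟩))
  · exact Or.inr (Or.inr (Or.inr ⟨h, ⟨ω'.out, h5⟩, ω.out, h2, hf, htrans ω hω⟩))

/-- If the orbit of `T` has three elements, the square of any element of `T` fixes another
element of the orbit. -/
theorem exists_ne_sq_smul_eq {T : NoncentralCentralizer G} {c : G} (hc : c ∈ T.1)
    (h : (MulAction.stabilizer G T).index = 3) :
    ∃ x : G, x • T ≠ T ∧ c ^ 2 • x • T = x • T := by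
  rw [MulAction.index_stabilizer] at h
  obtain ⟨A, B, C, hAB, hAC, hBC, hS⟩ := Set.ncard_eq_three.mp h
  have hmem : ∀ {Y}, Y ∈ MulAction.orbit G T ↔ Y = A ∨ Y = B ∨ Y = C := by
    intro Y; rw [hS]; simp
  have hcT : c • T = T := smul_eq_of_mem hc
  have hT : T = A ∨ T = B ∨ T = C := hmem.mp (MulAction.mem_orbit_self T)
  obtain ⟨Y, hY, hYT⟩ : ∃ Y ∈ MulAction.orbit G T, Y ≠ T := by
    rcases hT with rfl | rfl | rfl
    · exact ⟨B, hmem.mpr (by simp), hAB.symm⟩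
    · exact ⟨A, hmem.mpr (by simp), hAB⟩
    · exact ⟨A, hmem.mpr (by simp), hAC⟩
  have hinj : ∀ {U V : NoncentralCentralizer G}, c • U = c • V → U = V :=
    fun h => MulAction.injective c h
  have h1 : c • Y ≠ T := fun h => hYT (hinj (h.trans hcT.symm))
  have h2 : c • c • Y ≠ T := fun h => h1 (hinj (h.trans hcT.symm))
  have m0 := hmem.mp hY
  have m1 := hmem.mp ((MulAction.mem_orbit_of_mem_orbit c hY))
  have m2 := hmem.mp ((MulAction.mem_orbit_of_mem_orbit c (MulAction.mem_orbit_of_mem_orbit c hY)))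
  have h3 : c • c • Y = c • Y → c • Y = Y := fun h => hinj h
  -- `c` fixes `T`, hence permutes the other two points of the orbit, and its square fixes them.
  have key : c • c • Y = Y := by
    by_cases h4 : c • Y = Y
    · rw [h4, h4]
    · have h5 : c • c • Y ≠ c • Y := fun h => h4 (h3 h)
      grind
  obtain ⟨x, rfl⟩ := hY
  exact ⟨x, hYT, by rw [pow_two, mul_smul]; exact key⟩

/-- An abelian normal subgroup which is not central forces a centralizer of index at most two. -/
theorem exists_index_le_two [Finite G] (hAC : CentralizersAbelian G)
    (hN : CentralizersIndexTwo G)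
    {A : Subgroup G} [hA : A.Normal] (hcomm : ∀ a ∈ A, ∀ b ∈ A, a * b = b * a)
    (hle : ¬ A ≤ center G) : ∃ T : NoncentralCentralizer G, T.1.index ≤ 2 := by
  obtain ⟨a, haA, ha⟩ := SetLike.not_le_iff_exists.mp hle
  refine ⟨ofElement a ha, ?_⟩
  -- All conjugates of `a` lie in the abelian group `A`, so they commute with `a` and its
  -- centralizer is normalized by the whole group.
  have hst : MulAction.stabilizer G (ofElement a ha) = ⊤ := by
    rw [eq_top_iff]
    intro x _
    rw [MulAction.mem_stabilizer_iff, smul_eq_iff hAC]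
    exact hcomm _ (hA.conj_mem a haA x) a haA
  have := relIndex_mul_index (ofElement a ha).le_stabilizer
  rw [hst, index_top, mul_one] at this
  rw [← this, ← hst]
  change (ofElement a ha).indexNormalizer ≤ 2
  have := indexNormalizer_eq hAC hN (ofElement a ha)
  omega

end NoncentralCentralizer

variable {K : Type*} [Field K] {G : Type*} [Group G]
  {ρ : G →* Matrix.GeneralLinearGroup (Fin 2) K}

theorem commute_iff_of_injective (hρ : Function.Injective ρ) {a b : G} :
    Commute a b ↔ (ρ a).1 * (ρ b).1 = (ρ b).1 * (ρ a).1 := by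
  rw [commute_iff_eq, ← hρ.eq_iff, map_mul, map_mul, Units.ext_iff, Units.val_mul, Units.val_mul]

/-- A central non-scalar `g` would put all of `ρ(G)` in the commutative algebra `K[ρ g]`. -/
theorem mem_center_iff_isScalarMatrix (hρ : Function.Injective ρ)
    (hG : ¬ ∀ a b : G, Commute a b) {g : G} : g ∈ center G ↔ IsScalarMatrix (ρ g).1 := by
  constructor
  · intro hg
    by_contra hs
    apply hG
    intro a b
    have hc : ∀ a : G, ∃ α β : K, (ρ a).1 = α • 1 + β • (ρ g).1 := fun a =>
      exists_eq_add_smul_of_commute hs ((commute_iff_of_injective hρ).mp (mem_center_iff.mp hg a))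
    rw [commute_iff_of_injective hρ]
    obtain ⟨α, β, h1⟩ := hc a
    obtain ⟨γ, δ, h2⟩ := hc b
    rw [h1, h2]
    simp only [add_mul, mul_add, smul_mul_assoc, mul_smul_comm, one_mul, mul_one]
    module
  · rintro ⟨c, hc⟩
    rw [mem_center_iff]
    intro h
    apply (commute_iff_of_injective hρ).mpr
    rw [hc]
    simp

theorem centralizersAbelian_of_injective (hρ : Function.Injective ρ)
    (hG : ¬ ∀ a b : G, Commute a b) : CentralizersAbelian G := by
  intro g hg a b ha hb
  rw [mem_center_iff_isScalarMatrix hρ hG] at hg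
  rw [commute_iff_of_injective hρ] at *
  obtain ⟨α, β, h1⟩ := exists_eq_add_smul_of_commute hg ha
  obtain ⟨γ, δ, h2⟩ := exists_eq_add_smul_of_commute hg hb
  rw [h1, h2]
  simp only [add_mul, mul_add, smul_mul_assoc, mul_smul_comm, one_mul, mul_one]
  module

theorem trace_eq_zero_of_sq_mem_center (hρ : Function.Injective ρ)
    (hG : ¬ ∀ a b : G, Commute a b) {g : G} (hg : g ∉ center G) (h2 : g ^ 2 ∈ center G) :
    (ρ g).1.trace = 0 := by
  rw [mem_center_iff_isScalarMatrix hρ hG] at hg h2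
  rw [pow_two, map_mul, Units.val_mul] at h2
  exact trace_eq_zero_of_isScalarMatrix_sq hg h2

theorem sq_mem_center_of_trace_eq_zero (hρ : Function.Injective ρ)
    (hG : ¬ ∀ a b : G, Commute a b) {g : G} (h : (ρ g).1.trace = 0) : g ^ 2 ∈ center G := by
  rw [mem_center_iff_isScalarMatrix hρ hG, pow_two, map_mul, Units.val_mul]
  exact ⟨_, isScalarMatrix_sq_of_trace_eq_zero h⟩

theorem det_conj (x g : G) : (ρ (x * g * x⁻¹)).1.det = (ρ g).1.det := by
  rw [map_mul, map_mul, Units.val_mul, Units.val_mul, Matrix.det_mul, Matrix.det_mul, mul_right_comm,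
    ← Matrix.det_mul, ← Units.val_mul, ← map_mul, mul_inv_cancel, map_one, Units.val_one,
    Matrix.det_one, one_mul]

theorem trace_conj (x g : G) : (ρ (x * g * x⁻¹)).1.trace = (ρ g).1.trace := by
  rw [map_mul, map_mul, Units.val_mul, Units.val_mul, Matrix.trace_mul_comm, ← mul_assoc,
    ← Units.val_mul, ← map_mul, inv_mul_cancel, map_one, Units.val_one, one_mul]

theorem mul_mem_center_of_sq_mem_center [CharZero K] (hρ : Function.Injective ρ)
    (hG : ¬ ∀ a b : G, Commute a b) {a b : G} (ha : a ∉ center G) (hb : b ∉ center G)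
    (ha2 : a ^ 2 ∈ center G) (hb2 : b ^ 2 ∈ center G) (hab : Commute b a) :
    a * b ∈ center G := by
  have h1 := trace_eq_zero_of_sq_mem_center hρ hG ha ha2
  have h2 := trace_eq_zero_of_sq_mem_center hρ hG hb hb2
  rw [mem_center_iff_isScalarMatrix hρ hG] at ha ⊢
  rw [map_mul, Units.val_mul]
  exact isScalarMatrix_mul_of_commute_of_trace_eq_zero ha h1 h2
    ((commute_iff_of_injective hρ).mp hab)

open NoncentralCentralizer

/-- If two involutions modulo the center have conjugate centralizers, the product of their
determinants is a square. -/
theorem exists_det_mul_det_eq_sq [CharZero K] (hρ : Function.Injective ρ)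
    (hG : ¬ ∀ a b : G, Commute a b) {a b : G} (ha : a ∉ center G) (hb : b ∉ center G)
    (ha2 : a ^ 2 ∈ center G) (hb2 : b ^ 2 ∈ center G)
    (hab : ofElement b hb ∈ MulAction.orbit G (ofElement a ha)) :
    ∃ c : K, (ρ a).1.det * (ρ b).1.det = c ^ 2 := by
  obtain ⟨x, hx⟩ := hab
  have hx : x • ofElement a ha = ofElement b hb := hx
  have h1 := conj_mem_smul (x := x) (self_mem_ofElement ha)
  rw [hx, mem_ofElement] at h1
  have h2 : (x * a * x⁻¹) ^ 2 ∈ center G := by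
    rw [conj_pow]
    exact Normal.conj_mem inferInstance _ ha2 x
  -- A conjugate of `a` commutes with `b` and both are traceless, so their product is a scalar `c`,
  -- of determinant `c²`.
  have h3 := mul_mem_center_of_sq_mem_center hρ hG (conj_notMem_center x ha) hb h2 hb2 h1.symm
  rw [mem_center_iff_isScalarMatrix hρ hG, map_mul, Units.val_mul] at h3
  obtain ⟨c, hc⟩ := h3
  refine ⟨c, ?_⟩
  rw [← det_conj x a, ← Matrix.det_mul, hc, Matrix.det_smul, Matrix.det_one]
  simp

/-- A centralizer contains at most one involution modulo the center, so its quotient of order 4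
cannot be a Klein four-group. -/
theorem exists_sq_notMem_center [CharZero K] (hρ : Function.Injective ρ)
    (hG : ¬ ∀ a b : G, Commute a b) {T : NoncentralCentralizer G} (h4 : T.order = 4) :
    ∃ c ∈ T.1, c ^ 2 ∉ center G := by
  have hAC := centralizersAbelian_of_injective hρ hG
  by_contra! hc
  obtain ⟨g, hg, rfl⟩ := exists_eq_ofElement T
  have hgT := self_mem_ofElement hg
  have : (ofElement g hg).order ∣ 2 := by
    rw [NoncentralCentralizer.order, relIndex_dvd_two_iff]
    refine ⟨g, hgT, fun b hb => ?_⟩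
    by_cases hbZ : b ∈ center G
    · exact Or.inr hbZ
    · exact Or.inl (mul_mem_center_of_sq_mem_center hρ hG hbZ hg (hc b hb) (hc g hgT)
        (commute_of_mem hAC hgT hb))
  rw [h4] at this
  exact absurd this (by decide)

variable [Finite G] [CharZero K]

theorem anticommute_of_normalizing (hρ : Function.Injective ρ)
    (hG : ¬ ∀ a b : G, Commute a b) {g u : G} (hg : g ∉ center G)
    (hu : Commute (u * g * u⁻¹) g) (hug : ¬ Commute u g) :
    (ρ u).1 * ((2 : K) • (ρ g).1 - (ρ g).1.trace • 1) =
      -(((2 : K) • (ρ g).1 - (ρ g).1.trace • 1) * (ρ u).1) := by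
  rw [mem_center_iff_isScalarMatrix hρ hG] at hg
  rw [commute_iff_of_injective hρ] at hu hug
  have hd := disc_ne_zero_of_pow_eq_one hg Nat.card_pos (by
    rw [← Units.val_pow_eq_pow_val, ← map_pow, pow_card_eq_one', map_one, Units.val_one])
  refine (commute_or_anticommute (v := (ρ u⁻¹).1) hg hd ?_ ?_).resolve_left hug
  · rw [← Units.val_mul, ← map_mul, inv_mul_cancel, map_one, Units.val_one]
  · simpa only [map_mul, Units.val_mul] using hu

/-- Both elements anticommute with the traceless part of `g`, so their product commutes with it and
hence with `g`. -/
theorem centralizersIndexTwo_of_injective (hρ : Function.Injective ρ)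
    (hG : ¬ ∀ a b : G, Commute a b) : CentralizersIndexTwo G := by
  intro g hg u v hu hv hug hvg
  have h1 := anticommute_of_normalizing hρ hG hg hu hug
  have h2 := anticommute_of_normalizing hρ hG hg hv hvg
  rw [commute_iff_of_injective hρ, map_mul, Units.val_mul]
  set D := (2 : K) • (ρ g).1 - (ρ g).1.trace • (1 : Matrix (Fin 2) (Fin 2) K) with hD
  have h3 : (ρ v).1 * (ρ u).1 * D = D * ((ρ v).1 * (ρ u).1) := by
    rw [mul_assoc, h1, mul_neg, ← mul_assoc, h2, neg_mul, neg_neg, mul_assoc]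
  have h4 : (ρ g).1 = (2⁻¹ : K) • D + ((2⁻¹ : K) * (ρ g).1.trace) • 1 := by
    rw [hD, smul_sub, smul_smul, smul_smul, inv_mul_cancel₀ two_ne_zero, one_smul,
      sub_add_cancel]
  rw [h4]
  simp only [add_mul, mul_add, smul_mul_assoc, mul_smul_comm, one_mul, mul_one] at h3 ⊢
  rw [h3]

/-- A normalizing element `u` anticommutes with `g`, so `g`, `u` and `gu` are traceless involutions
modulo the center. Their centralizers have even order, hence are all conjugate, which makes `det g ·
det u` and `det g · det (gu)` squares; then `det g` and `det u` are squares themselves. -/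
theorem negOneIsSumOfTwoSquares_of_unique_even (hρ : Function.Injective ρ)
    (hG : ¬ ∀ a b : G, Commute a b) {T : NoncentralCentralizer G} (h2 : T.order = 2)
    (hf : T.indexNormalizer = 2)
    (hT : ∀ T' : NoncentralCentralizer G, Even T'.order → T' ∈ MulAction.orbit G T) :
    NegOneIsSumOfTwoSquares K := by
  have hAC := centralizersAbelian_of_injective hρ hG
  obtain ⟨g, hg, rfl⟩ := exists_eq_ofElement T
  have hg2 : g ^ 2 ∈ center G := by
    have := pow_order_mem (self_mem_ofElement hg)
    rwa [h2] at this
  have hgt := trace_eq_zero_of_sq_mem_center hρ hG hg hg2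
  obtain ⟨u, hu, hug⟩ := exists_normalizing hAC hg hf
  have hanti := anticommute_of_normalizing hρ hG hg hu hug
  rw [hgt, zero_smul, sub_zero, mul_smul_comm, smul_mul_assoc, ← smul_neg] at hanti
  have hanti := smul_right_injective _ (two_ne_zero (α := K)) hanti
  have hdet : ∀ x : G, (ρ x).1.det ≠ 0 := fun x =>
    ((Matrix.isUnit_iff_isUnit_det _).mp (ρ x).isUnit).ne_zero
  have hcancel : ∀ t : K, t = -t → t = 0 := fun t ht => by
    have : 2 * t = 0 := by linear_combination ht
    simpa using this
  have hut : (ρ u).1.trace = 0 := by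
    apply hcancel
    have h1 : (ρ (g * u * g⁻¹)).1 = -(ρ u).1 := by
      rw [map_mul, map_mul, Units.val_mul, Units.val_mul,
        show (ρ g).1 * (ρ u).1 = -((ρ u).1 * (ρ g).1) by rw [hanti, neg_neg], neg_mul, mul_assoc,
        ← Units.val_mul, ← map_mul, mul_inv_cancel, map_one, Units.val_one, mul_one]
    rw [← Matrix.trace_neg, ← h1, trace_conj]
  have hgut : (ρ (g * u)).1.trace = 0 := by
    apply hcancel
    rw [map_mul, Units.val_mul, ← Matrix.trace_neg, Matrix.trace_mul_comm, hanti]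
  have hu' : u ∉ center G := fun h => hug (mem_center_iff.mp h g).symm
  have hgu' : g * u ∉ center G := by
    intro h
    apply hug
    have h1 : g * (g * u) = g * u * g := mem_center_iff.mp h g
    rw [mul_assoc g u g] at h1
    exact (mul_left_cancel h1).symm
  have hu2 := sq_mem_center_of_trace_eq_zero hρ hG hut
  have hgu2 := sq_mem_center_of_trace_eq_zero hρ hG hgut
  obtain ⟨c, hc⟩ := exists_det_mul_det_eq_sq hρ hG hg hu' hg2 hu2
    (hT _ (even_order_ofElement hu' hu2))
  obtain ⟨d, hd⟩ := exists_det_mul_det_eq_sq hρ hG hg hgu' hg2 hgu2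
    (hT _ (even_order_ofElement hgu' hgu2))
  rw [map_mul, Units.val_mul, Matrix.det_mul] at hd
  have hg0 := hdet g
  have hu0 := hdet u
  have hd0 : d ≠ 0 := by
    rintro rfl
    simp [hg0, hu0] at hd
  have hsq : ∀ (x : G) (p : K), (ρ x).1.trace = 0 → (ρ x).1.det * p ^ 2 = 1 →
      (p • (ρ x).1) * (p • (ρ x).1) = -1 := by
    intro x p ht hp
    rw [smul_mul_smul_comm, isScalarMatrix_sq_of_trace_eq_zero ht, smul_smul,
      show p * p * -(ρ x).1.det = -1 by linear_combination -hp]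
    simp
  -- From `det g · det u = c²` and `(det g)² · det u = d²`, the scalars are inverse square roots of
  -- `det g` and `det u`.
  refine negOneIsSumOfTwoSquares_of_quaternion
    (hsq g (d / ((ρ g).1.det * c)) hgt ?_) (hsq u ((ρ g).1.det / d) hut ?_) ?_
  · have hc0 : c ≠ 0 := by
      rintro rfl
      simp [hg0, hu0] at hc
    field_simp
    rw [← hc, ← hd]
  · field_simp
    rw [← hd]
    ring
  · rw [smul_mul_smul_comm, smul_mul_smul_comm, hanti, mul_comm (_ / d), smul_neg, neg_neg]

/-- Take `c` of order 4 modulo the center, so `tr² = 2 det`. Its traceless part divided by `tr`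
squares to `-1`, and `c²` is a multiple of that part. Since `c²` normalizes but does not centralize
a conjugate of `c`, the normalized traceless parts of `c` and of that conjugate anticommute. -/
theorem negOneIsSumOfTwoSquares_of_order_four (hρ : Function.Injective ρ)
    (hG : ¬ ∀ a b : G, Commute a b) (hn : (center G).index = 24)
    {T : NoncentralCentralizer G} (h4 : T.order = 4) (hf : T.indexNormalizer = 2) :
    NegOneIsSumOfTwoSquares K ∧ ∃ ζ : K, IsRootOfUnity (2 * ζ ^ 2) := by
  have hAC := centralizersAbelian_of_injective hρ hG
  obtain ⟨c, hcT, hc2⟩ := exists_sq_notMem_center hρ hG h4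
  have hc4 : c ^ 4 ∈ center G := by
    have := pow_order_mem hcT
    rwa [h4] at this
  have hc : c ∉ center G := fun h => hc2 (pow_mem h 2)
  have hst : (MulAction.stabilizer G T).index = 3 := by
    have := T.order_mul_index
    rw [h4, hf, hn] at this
    omega
  obtain ⟨x, hxT, hx⟩ := exists_ne_sq_smul_eq hcT hst
  have hTc := eq_ofElement hAC hc hcT
  have hTc2 := eq_ofElement hAC hc2 (pow_mem hcT 2)
  have hx' := conj_notMem_center x hc
  have hc2' := hc2
  rw [mem_center_iff_isScalarMatrix hρ hG, pow_two, map_mul, Units.val_mul] at hc2'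
  rw [mem_center_iff_isScalarMatrix hρ hG, map_pow, Units.val_pow_eq_pow_val] at hc4
  obtain ⟨ht, htd⟩ := trace_sq_of_pow_four hc2' hc4
  have hxTc : x • T = ofElement (x * c * x⁻¹) hx' := by rw [hTc, smul_ofElement]
  constructor
  · rw [hxTc, smul_eq_iff hAC] at hx
    have hncomm : ¬ Commute (c ^ 2) (x * c * x⁻¹) := by
      intro h
      apply hxT
      rw [← mem_ofElement hx', ← hxTc] at h
      rw [eq_ofElement hAC hc2 h, ← hTc2]
    have hanti := anticommute_of_normalizing hρ hG hx' hx hncomm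
    have htx := trace_conj (ρ := ρ) x c
    have hdx := det_conj (ρ := ρ) x c
    have hsq : ∀ g : Matrix (Fin 2) (Fin 2) K, g.trace = (ρ c).1.trace → g.det = (ρ c).1.det →
        ((ρ c).1.trace⁻¹ • ((2 : K) • g - g.trace • 1)) *
          ((ρ c).1.trace⁻¹ • ((2 : K) • g - g.trace • 1)) = -1 := by
      intro g hgt hgd
      rw [smul_mul_smul_comm]
      simp only [sub_mul, mul_sub, smul_mul_assoc, mul_smul_comm, one_mul, mul_one,
        matrixTwo_mul_self g, hgt, hgd]
      rw [show (ρ c).1.det = (ρ c).1.trace ^ 2 / 2 by rw [htd]; field_simp]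
      match_scalars <;> field_simp <;> ring
    have hu : (ρ (c ^ 2)).1 = ((ρ c).1.trace / 2) •
        ((2 : K) • (ρ c).1 - (ρ c).1.trace • (1 : Matrix (Fin 2) (Fin 2) K)) := by
      rw [pow_two, map_mul, Units.val_mul, matrixTwo_mul_self,
        show (ρ c).1.det = (ρ c).1.trace ^ 2 / 2 by rw [htd]; field_simp]
      match_scalars <;> field_simp
    refine negOneIsSumOfTwoSquares_of_quaternion (hsq _ rfl rfl) (hsq _ htx hdx) ?_
    rw [hu, smul_mul_assoc, mul_smul_comm, ← smul_neg] at hanti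
    have := smul_right_injective _ (div_ne_zero ht (two_ne_zero (α := K))) hanti
    rw [smul_mul_smul_comm, smul_mul_smul_comm, this, smul_neg]
  · refine ⟨(ρ c).1.trace⁻¹, Nat.card G, Nat.card_pos, ?_⟩
    have h0 : (ρ c).1.det ≠ 0 := ((Matrix.isUnit_iff_isUnit_det _).mp (ρ c).isUnit).ne_zero
    rw [show 2 * (ρ c).1.trace⁻¹ ^ 2 = (ρ c).1.det⁻¹ by
      rw [inv_pow, htd]; field_simp, inv_pow, ← Matrix.det_pow, ← Units.val_pow_eq_pow_val,
      ← map_pow, pow_card_eq_one', map_one, Units.val_one, Matrix.det_one, inv_one]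

/-- The structure of a finite non-abelian subgroup of `GL₂(K)`. -/
theorem finite_linear_group_cases (hρ : Function.Injective ρ) (hG : ¬ ∀ a b : G, Commute a b) :
    (∃ T : NoncentralCentralizer G, T.1.index ≤ 2) ∨
    (NegOneIsSumOfTwoSquares K ∧
      (((center G).index = 12 ∧ ∀ g : G, g ^ 4 ∈ center G → g ^ 2 ∈ center G) ∨
      ((center G).index = 24 ∧ ∃ ζ : K, IsRootOfUnity (2 * ζ ^ 2)) ∨
      ((center G).index = 60 ∧ ∃ s : K, s ^ 2 = 5))) := by
  have hAC := centralizersAbelian_of_injective hρ hG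
  have hN := centralizersIndexTwo_of_injective hρ hG
  rcases configurations hG hAC hN with h | ⟨h, h23, T, h2, hf, hT⟩ | ⟨h, T, h4, hf⟩ |
    ⟨h, ⟨T', h5⟩, T, h2, hf, hT⟩
  · exact Or.inl h
  · refine Or.inr ⟨negOneIsSumOfTwoSquares_of_unique_even hρ hG h2 hf hT, Or.inl ⟨h, ?_⟩⟩
    intro g hg4
    by_cases hg : g ∈ center G
    · exact pow_mem hg 2
    · have h1 := pow_order_mem (self_mem_ofElement hg)
      rcases h23 (ofElement g hg) with h3 | h3 <;> rw [h3] at h1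
      · exact h1
      · exact absurd ((mul_mem_cancel_left h1).mp (by rwa [← pow_succ])) hg
  · obtain ⟨h1, h3⟩ := negOneIsSumOfTwoSquares_of_order_four hρ hG h h4 hf
    exact Or.inr ⟨h1, Or.inr (Or.inl ⟨h, h3⟩)⟩
  · refine Or.inr ⟨negOneIsSumOfTwoSquares_of_unique_even hρ hG h2 hf hT,
      Or.inr (Or.inr ⟨h, ?_⟩)⟩
    obtain ⟨g, hg, rfl⟩ := exists_eq_ofElement T'
    have h1 := pow_order_mem (self_mem_ofElement hg)
    rw [h5, mem_center_iff_isScalarMatrix hρ hG, map_pow, Units.val_pow_eq_pow_val] at h1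
    rw [mem_center_iff_isScalarMatrix hρ hG] at hg
    exact exists_sq_eq_five_of_pow_five hg
      ((Matrix.isUnit_iff_isUnit_det _).mp (ρ g).isUnit).ne_zero h1

end FiniteLinearGroups

/-! ### Finite stabilizers of configurations of quaternions. -/

section FiniteStabilizers

variable {K : Type*} [Field K]

/-- The matrices `± v i`. -/
def signedRange {n : ℕ} (v : Fin n → Matrix (Fin 2) (Fin 2) K) : Set (Matrix (Fin 2) (Fin 2) K) :=
  {s | ∃ i, s = v i ∨ s = -v i}

theorem signedRange_finite {n : ℕ} (v : Fin n → Matrix (Fin 2) (Fin 2) K) :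
    (signedRange v).Finite := by
  have : signedRange v = Set.range v ∪ Set.range (fun i => -v i) := by
    ext s
    simp only [signedRange, Set.mem_ofPred_eq, Set.mem_union, Set.mem_range, exists_or, eq_comm]
  rw [this]
  exact (Set.finite_range _).union (Set.finite_range _)

/-- The elements of `GL₂(K)` of determinant an `m`-th root of unity which permute the matrices
`± v i` by conjugation. -/
noncomputable def conjStabilizer {n : ℕ} (v : Fin n → Matrix (Fin 2) (Fin 2) K) (m : ℕ) :
    Subgroup (Matrix.GeneralLinearGroup (Fin 2) K) where
  carrier := {g | (∀ s ∈ signedRange v, g.1 * s * g⁻¹.1 ∈ signedRange v) ∧ g.1.det ^ m = 1}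
  one_mem' := by simp
  mul_mem' := by
    rintro g h ⟨hg, hg'⟩ ⟨hh, hh'⟩
    refine ⟨fun s hs => ?_, ?_⟩
    · have := hg _ (hh s hs)
      rw [mul_inv_rev, Units.val_mul, Units.val_mul]
      simpa only [mul_assoc] using this
    · rw [Units.val_mul, Matrix.det_mul, mul_pow, hg', hh', one_mul]
  inv_mem' := by
    rintro g ⟨hg, hg'⟩
    have hinv : ∀ s : Matrix (Fin 2) (Fin 2) K, g⁻¹.1 * (g.1 * s * g⁻¹.1) * g.1 = s := by
      intro s
      calc g⁻¹.1 * (g.1 * s * g⁻¹.1) * g.1 = (g⁻¹.1 * g.1) * s * (g⁻¹.1 * g.1) := by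
            noncomm_ring
        _ = s := by rw [← Units.val_mul, inv_mul_cancel, Units.val_one, one_mul, mul_one]
    refine ⟨fun s hs => ?_, ?_⟩
    · have hinj : Function.Injective (fun s => g.1 * s * g⁻¹.1) := fun s t hst => by
        rw [← hinv s, ← hinv t]
        exact congrArg (fun s => g⁻¹.1 * s * g.1) hst
      -- Conjugation is an injective self-map of a finite set, hence onto, so the inverse preserves
      -- the set too.
      have himage : (fun s => g.1 * s * g⁻¹.1) '' signedRange v = signedRange v := by
        apply Set.eq_of_subset_of_ncard_le
        · rintro _ ⟨s, hs, rfl⟩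
          exact hg s hs
        · rw [Set.ncard_image_of_injective _ hinj]
        · exact signedRange_finite v
      rw [← himage] at hs
      obtain ⟨t, ht, rfl⟩ := hs
      rw [inv_inv]
      simpa only [hinv] using ht
    · have h1 : g⁻¹.1.det * g.1.det = 1 := by
        rw [← Matrix.det_mul, ← Units.val_mul, inv_mul_cancel, Units.val_one, Matrix.det_one]
      have := congrArg (· ^ m) h1
      simpa only [mul_pow, hg', mul_one, one_pow] using this

/-- There are finitely many actions on the `v i`. Two elements acting alike differ by a scalar `c`,
and comparing determinants gives `c ^ (2 * m) = 1`. -/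
theorem conjStabilizer_finite {n : ℕ} (v : Fin n → Matrix (Fin 2) (Fin 2) K) {m : ℕ} (hm : 0 < m)
    (hv : ∀ M : Matrix (Fin 2) (Fin 2) K, (∀ i, M * v i = v i * M) → IsScalarMatrix M) :
    Finite (conjStabilizer v m) := by
  change Set.Finite (conjStabilizer v m : Set (Matrix.GeneralLinearGroup (Fin 2) K))
  refine Set.Finite.of_finite_fibers
    (fun (g : Matrix.GeneralLinearGroup (Fin 2) K) (i : Fin n) => g.1 * v i * g⁻¹.1) ?_ ?_
  · refine (Set.Finite.pi' fun _ : Fin n => signedRange_finite v).subset ?_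
    rintro _ ⟨g, hg, rfl⟩ i
    exact hg.1 _ ⟨i, Or.inl rfl⟩
  · rintro _ ⟨g, hg, rfl⟩
    have hroots : {c : K | c ^ (2 * m) = 1}.Finite := by
      classical
      refine (Polynomial.nthRoots (2 * m) (1 : K)).toFinset.finite_toSet.subset fun c hc => ?_
      simpa [Polynomial.mem_nthRoots (show 0 < 2 * m by omega)] using hc
    refine Set.Finite.of_finite_image ((hroots.image fun c => c • g.1).subset ?_)
      (f := Units.val) (Units.val_injective.injOn)
    rintro _ ⟨h, ⟨hh, hgh⟩, rfl⟩
    have hgh : ∀ i, h.1 * v i * h⁻¹.1 = g.1 * v i * g⁻¹.1 := fun i => congrFun hgh i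
    obtain ⟨c, hc⟩ := hv (g⁻¹.1 * h.1) fun i => by
      calc g⁻¹.1 * h.1 * v i = g⁻¹.1 * (h.1 * v i * h⁻¹.1) * h.1 := by
            simp only [mul_assoc]
            rw [← Units.val_mul h⁻¹, inv_mul_cancel, Units.val_one, mul_one]
        _ = v i * (g⁻¹.1 * h.1) := by
            rw [hgh i]
            simp only [← mul_assoc]
            rw [← Units.val_mul g⁻¹, inv_mul_cancel, Units.val_one, one_mul]
    have hh1 : h.1 = c • g.1 := by
      rw [← one_mul h.1, ← Units.val_one, ← mul_inv_cancel g, Units.val_mul, mul_assoc, hc]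
      simp
    refine ⟨c, ?_, hh1.symm⟩
    have h2 := hh.2
    have h3 := hg.2
    rw [hh1, Matrix.det_smul, Fintype.card_fin, mul_pow, h3, mul_one, ← pow_mul] at h2
    exact h2

theorem mem_conjStabilizer {n : ℕ} {v : Fin n → Matrix (Fin 2) (Fin 2) K} {m : ℕ}
    {g : Matrix.GeneralLinearGroup (Fin 2) K} (hg : g.1.det ^ m = 1)
    (h : ∀ i, ∃ j, g.1 * v i = v j * g.1 ∨ g.1 * v i = -v j * g.1) : g ∈ conjStabilizer v m := by
  have key : ∀ i, g.1 * v i * g⁻¹.1 ∈ signedRange v := by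
    intro i
    obtain ⟨j, hj | hj⟩ := h i
    · refine ⟨j, Or.inl ?_⟩
      rw [hj, mul_assoc, ← Units.val_mul, mul_inv_cancel, Units.val_one, mul_one]
    · refine ⟨j, Or.inr ?_⟩
      rw [hj, mul_assoc, ← Units.val_mul, mul_inv_cancel, Units.val_one, mul_one]
  refine ⟨?_, hg⟩
  rintro _ ⟨i, rfl | rfl⟩
  · exact key i
  · obtain ⟨j, hj | hj⟩ := key i
    · exact ⟨j, Or.inr (by rw [mul_neg, neg_mul, hj])⟩
    · exact ⟨j, Or.inl (by rw [mul_neg, neg_mul, hj, neg_neg])⟩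

/-- The image in `M₂(K)` of the quaternion `a + b i + c j + d k`, where `x ^ 2 + y ^ 2 = -1`. -/
def quaternionMatrix (x y a b c d : K) : Matrix (Fin 2) (Fin 2) K :=
  !![a + b * x - d * y, b * y + c + d * x; b * y - c + d * x, a - b * x + d * y]

variable {x y : K}

theorem quaternionMatrix_mul (h : (-1 : K) = x ^ 2 + y ^ 2) (a b c d a' b' c' d' : K) :
    quaternionMatrix x y a b c d * quaternionMatrix x y a' b' c' d' =
      quaternionMatrix x y (a * a' - b * b' - c * c' - d * d')
        (a * b' + b * a' + c * d' - d * c') (a * c' + c * a' + d * b' - b * d')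
        (a * d' + d * a' + b * c' - c * b') := by
  simp only [quaternionMatrix, matrixTwo_eq_iff, Matrix.mul_apply, Fin.sum_univ_two]
  simp
  refine ⟨?_, ?_, ?_, ?_⟩
  · linear_combination (-(b * b' + d * d')) * h
  · linear_combination (d * b' - b * d') * h
  · linear_combination (b * d' - d * b') * h
  · linear_combination (-(b * b' + d * d')) * h

theorem quaternionMatrix_det (h : (-1 : K) = x ^ 2 + y ^ 2) (a b c d : K) :
    (quaternionMatrix x y a b c d).det = a ^ 2 + b ^ 2 + c ^ 2 + d ^ 2 := by
  simp only [quaternionMatrix, Matrix.det_fin_two_of]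
  linear_combination (b ^ 2 + d ^ 2) * h

theorem quaternionMatrix_neg (a b c d : K) :
    -quaternionMatrix x y a b c d = quaternionMatrix x y (-a) (-b) (-c) (-d) := by
  simp only [quaternionMatrix, matrixTwo_eq_iff]
  simp
  refine ⟨?_, ?_, ?_, ?_⟩ <;> ring

theorem quaternionMatrix_add (a b c d a' b' c' d' : K) :
    quaternionMatrix x y a b c d + quaternionMatrix x y a' b' c' d' =
      quaternionMatrix x y (a + a') (b + b') (c + c') (d + d') := by
  simp only [quaternionMatrix, matrixTwo_eq_iff]
  simp
  refine ⟨?_, ?_, ?_, ?_⟩ <;> ring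

theorem quaternionMatrix_congr {a b c d a' b' c' d' : K} (ha : a = a') (hb : b = b')
    (hc : c = c') (hd : d = d') :
    quaternionMatrix x y a b c d = quaternionMatrix x y a' b' c' d' := by
  rw [ha, hb, hc, hd]

theorem quaternionMatrix_isScalarMatrix_iff [CharZero K] (h : (-1 : K) = x ^ 2 + y ^ 2) {a b c d : K} :
    IsScalarMatrix (quaternionMatrix x y a b c d) ↔ b = 0 ∧ c = 0 ∧ d = 0 := by
  rw [isScalarMatrix_iff]
  simp only [quaternionMatrix, Matrix.of_apply, Matrix.cons_val', Matrix.cons_val_zero,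
    Matrix.cons_val_one, Matrix.cons_val_fin_one]
  constructor
  · rintro ⟨h1, h2, h3⟩
    have h4 : 2 * c = 0 := by linear_combination h1 - h2
    have hc : c = 0 := by simpa using h4
    have h5 : 2 * (b * x - d * y) = 0 := by linear_combination h3
    have h5 : b * x - d * y = 0 := by simpa using h5
    -- The linear system `bx - dy = 0`, `by + dx = 0` has determinant `x² + y² = -1`.
    refine ⟨?_, hc, ?_⟩
    · linear_combination (-b) * h - x * h5 - y * h1 + y * hc
    · linear_combination (-d) * h + y * h5 - x * h1 + x * hc
  · rintro ⟨rfl, rfl, rfl⟩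
    simp

/-- A matrix commuting with the images of the quaternions `i` and `j` is scalar. -/
theorem isScalarMatrix_of_commute [CharZero K] (h : (-1 : K) = x ^ 2 + y ^ 2) {M : Matrix (Fin 2) (Fin 2) K}
    (hi : M * quaternionMatrix x y 0 1 0 0 = quaternionMatrix x y 0 1 0 0 * M)
    (hj : M * quaternionMatrix x y 0 0 1 0 = quaternionMatrix x y 0 0 1 0 * M) :
    IsScalarMatrix M := by
  have hs : ¬ IsScalarMatrix (quaternionMatrix x y 0 1 0 0) := by
    rw [quaternionMatrix_isScalarMatrix_iff h]
    simp
  obtain ⟨α, β, rfl⟩ := exists_eq_add_smul_of_commute hs hi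
  have h1 : β • (quaternionMatrix x y 0 1 0 0 * quaternionMatrix x y 0 0 1 0) =
      β • (quaternionMatrix x y 0 0 1 0 * quaternionMatrix x y 0 1 0 0) := by
    simpa [add_mul, mul_add] using hj
  -- Otherwise `i` and `j` would commute, making `ij - ji = 2k` zero.
  have hβ : β = 0 := by
    by_contra hβ
    have h2 := smul_right_injective _ hβ h1
    rw [quaternionMatrix_mul h, quaternionMatrix_mul h] at h2
    have h3 : IsScalarMatrix (quaternionMatrix x y 0 0 0 2) := by
      refine ⟨0, ?_⟩
      rw [zero_smul, ← sub_eq_zero.mpr h2, sub_eq_add_neg, quaternionMatrix_neg,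
        quaternionMatrix_add]
      apply quaternionMatrix_congr <;> norm_num
    rw [quaternionMatrix_isScalarMatrix_iff h] at h3
    exact two_ne_zero h3.2.2
  exact ⟨α, by rw [hβ]; simp⟩

/-- The vertices of an octahedron, up to sign. -/
def octahedron (x y : K) : Fin 3 → Matrix (Fin 2) (Fin 2) K :=
  ![quaternionMatrix x y 0 1 0 0, quaternionMatrix x y 0 0 1 0, quaternionMatrix x y 0 0 0 1]

/-- The vertices of an icosahedron, up to sign. -/
def icosahedron (x y φ : K) : Fin 6 → Matrix (Fin 2) (Fin 2) K :=
  ![quaternionMatrix x y 0 0 1 φ, quaternionMatrix x y 0 0 1 (-φ),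
    quaternionMatrix x y 0 φ 0 1, quaternionMatrix x y 0 (-φ) 0 1,
    quaternionMatrix x y 0 1 φ 0, quaternionMatrix x y 0 1 (-φ) 0]

theorem octahedron_commutant [CharZero K] (h : (-1 : K) = x ^ 2 + y ^ 2) (M : Matrix (Fin 2) (Fin 2) K)
    (hM : ∀ i, M * octahedron x y i = octahedron x y i * M) : IsScalarMatrix M :=
  isScalarMatrix_of_commute h (hM 0) (hM 1)

theorem icosahedron_commutant [CharZero K] (h : (-1 : K) = x ^ 2 + y ^ 2) (φ : K)
    (M : Matrix (Fin 2) (Fin 2) K)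
    (hM : ∀ i, M * icosahedron x y φ i = icosahedron x y φ i * M) : IsScalarMatrix M := by
  have half : ∀ {A B : Matrix (Fin 2) (Fin 2) K}, A = B + B → M * A = A * M → M * B = B * M := by
    rintro A B rfl hA
    rw [mul_add, add_mul, ← two_smul K, ← two_smul K (B * M)] at hA
    exact smul_right_injective _ (two_ne_zero (α := K)) hA
  have h0 := hM 0
  have h1 := hM 1
  have h4 := hM 4
  have h5 := hM 5
  -- Sums of two vertices give `2i` and `2j`, reducing to the commutant of `i` and `j`.
  have h45 : M * (icosahedron x y φ 4 + icosahedron x y φ 5) =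
      (icosahedron x y φ 4 + icosahedron x y φ 5) * M := by rw [mul_add, add_mul, h4, h5]
  have h01 : M * (icosahedron x y φ 0 + icosahedron x y φ 1) =
      (icosahedron x y φ 0 + icosahedron x y φ 1) * M := by rw [mul_add, add_mul, h0, h1]
  refine isScalarMatrix_of_commute h (half ?_ h45) (half ?_ h01)
  · simp only [icosahedron, Matrix.cons_val]
    rw [quaternionMatrix_add, quaternionMatrix_add]
    apply quaternionMatrix_congr <;> ring
  · simp only [icosahedron, Matrix.cons_val]
    rw [quaternionMatrix_add, quaternionMatrix_add]
    apply quaternionMatrix_congr <;> ring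

/-- The rotation of order three permuting `i`, `j`, `k` up to the sign `ε`. -/
theorem octahedron_three_mem [CharZero K] (h : (-1 : K) = x ^ 2 + y ^ 2) {ε : K} (hε : ε = 1 ∨ ε = -1)
    {g : Matrix.GeneralLinearGroup (Fin 2) K}
    (hg : g.1 = quaternionMatrix x y (-1 / 2) (1 / 2) (ε / 2) (ε / 2)) (m : ℕ) :
    g ∈ conjStabilizer (octahedron x y) m := by
  apply mem_conjStabilizer
  · rw [hg, quaternionMatrix_det h]
    rcases hε with rfl | rfl <;> norm_num
  · rw [hg]
    rcases hε with rfl | rfl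
    · intro i
      fin_cases i
      · refine ⟨2, Or.inl ?_⟩
        simp only [Fin.zero_eta, Matrix.cons_val, octahedron, quaternionMatrix_mul h]
        apply quaternionMatrix_congr <;> ring
      · refine ⟨0, Or.inl ?_⟩
        simp only [Fin.mk_one, Matrix.cons_val, octahedron, quaternionMatrix_mul h]
        apply quaternionMatrix_congr <;> ring
      · refine ⟨1, Or.inl ?_⟩
        simp only [Fin.reduceFinMk, Matrix.cons_val, octahedron, quaternionMatrix_mul h]
        apply quaternionMatrix_congr <;> ring
    · intro i
      fin_cases i
      · refine ⟨2, Or.inr ?_⟩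
        simp only [Fin.zero_eta, Matrix.cons_val, octahedron, quaternionMatrix_mul h, quaternionMatrix_neg]
        apply quaternionMatrix_congr <;> ring
      · refine ⟨0, Or.inr ?_⟩
        simp only [Fin.mk_one, Matrix.cons_val, octahedron, quaternionMatrix_mul h, quaternionMatrix_neg]
        apply quaternionMatrix_congr <;> ring
      · refine ⟨1, Or.inl ?_⟩
        simp only [Fin.reduceFinMk, Matrix.cons_val, octahedron, quaternionMatrix_mul h]
        apply quaternionMatrix_congr <;> ring

/-- Conjugation by `1 + i` is the quarter turn about the axis `i`; the factor `ζ` only serves to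
make the determinant `2ζ²` a root of unity. -/
theorem octahedron_four_mem (h : (-1 : K) = x ^ 2 + y ^ 2) {ζ : K} {m : ℕ}
    (hζ : (2 * ζ ^ 2) ^ m = 1) {g : Matrix.GeneralLinearGroup (Fin 2) K}
    (hg : g.1 = quaternionMatrix x y ζ ζ 0 0) : g ∈ conjStabilizer (octahedron x y) m := by
  apply mem_conjStabilizer
  · rw [hg, quaternionMatrix_det h, ← hζ]
    ring
  · rw [hg]
    intro i
    fin_cases i
    · refine ⟨0, Or.inl ?_⟩
      simp only [Fin.zero_eta, Matrix.cons_val, octahedron, quaternionMatrix_mul h]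
      apply quaternionMatrix_congr <;> ring
    · refine ⟨2, Or.inl ?_⟩
      simp only [Fin.mk_one, Matrix.cons_val, octahedron, quaternionMatrix_mul h]
      apply quaternionMatrix_congr <;> ring
    · refine ⟨1, Or.inr ?_⟩
      simp only [Fin.reduceFinMk, Matrix.cons_val, octahedron, quaternionMatrix_mul h, quaternionMatrix_neg]
      apply quaternionMatrix_congr <;> ring

theorem icosahedron_three_mem [CharZero K] (h : (-1 : K) = x ^ 2 + y ^ 2) (φ : K) {ε : K} (hε : ε = 1 ∨ ε = -1)
    {g : Matrix.GeneralLinearGroup (Fin 2) K}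
    (hg : g.1 = quaternionMatrix x y (-1 / 2) (1 / 2) (ε / 2) (ε / 2)) (m : ℕ) :
    g ∈ conjStabilizer (icosahedron x y φ) m := by
  apply mem_conjStabilizer
  · rw [hg, quaternionMatrix_det h]
    rcases hε with rfl | rfl <;> norm_num
  · rw [hg]
    rcases hε with rfl | rfl
    · intro i
      fin_cases i
      · refine ⟨4, Or.inl ?_⟩
        simp only [Fin.zero_eta, Matrix.cons_val, icosahedron, quaternionMatrix_mul h]
        apply quaternionMatrix_congr <;> ring
      · refine ⟨5, Or.inl ?_⟩
        simp only [Fin.mk_one, Matrix.cons_val, icosahedron, quaternionMatrix_mul h]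
        apply quaternionMatrix_congr <;> ring
      · refine ⟨0, Or.inl ?_⟩
        simp only [Fin.reduceFinMk, Matrix.cons_val, icosahedron, quaternionMatrix_mul h]
        apply quaternionMatrix_congr <;> ring
      · refine ⟨1, Or.inl ?_⟩
        simp only [Fin.reduceFinMk, Matrix.cons_val, icosahedron, quaternionMatrix_mul h]
        apply quaternionMatrix_congr <;> ring
      · refine ⟨2, Or.inl ?_⟩
        simp only [Fin.reduceFinMk, Matrix.cons_val, icosahedron, quaternionMatrix_mul h]
        apply quaternionMatrix_congr <;> ring
      · refine ⟨3, Or.inl ?_⟩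
        simp only [Fin.reduceFinMk, Matrix.cons_val, icosahedron, quaternionMatrix_mul h]
        apply quaternionMatrix_congr <;> ring
    · intro i
      fin_cases i
      · refine ⟨5, Or.inr ?_⟩
        simp only [Fin.zero_eta, Matrix.cons_val, icosahedron, quaternionMatrix_mul h, quaternionMatrix_neg]
        apply quaternionMatrix_congr <;> ring
      · refine ⟨4, Or.inr ?_⟩
        simp only [Fin.mk_one, Matrix.cons_val, icosahedron, quaternionMatrix_mul h, quaternionMatrix_neg]
        apply quaternionMatrix_congr <;> ring
      · refine ⟨1, Or.inl ?_⟩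
        simp only [Fin.reduceFinMk, Matrix.cons_val, icosahedron, quaternionMatrix_mul h]
        apply quaternionMatrix_congr <;> ring
      · refine ⟨0, Or.inl ?_⟩
        simp only [Fin.reduceFinMk, Matrix.cons_val, icosahedron, quaternionMatrix_mul h]
        apply quaternionMatrix_congr <;> ring
      · refine ⟨2, Or.inr ?_⟩
        simp only [Fin.reduceFinMk, Matrix.cons_val, icosahedron, quaternionMatrix_mul h, quaternionMatrix_neg]
        apply quaternionMatrix_congr <;> ring
      · refine ⟨3, Or.inr ?_⟩
        simp only [Fin.reduceFinMk, Matrix.cons_val, icosahedron, quaternionMatrix_mul h, quaternionMatrix_neg]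
        apply quaternionMatrix_congr <;> ring

/-- A fifth of a turn about the vertex `j + φk`: the vector part `(φ - 1) j + k` is proportional to
it as `φ (φ - 1) = 1`, and `φ / 2` is the cosine of 36° for the golden ratio. -/
theorem icosahedron_five_mem [CharZero K] (h : (-1 : K) = x ^ 2 + y ^ 2) {φ : K} (hφ : φ ^ 2 = φ + 1)
    {g : Matrix.GeneralLinearGroup (Fin 2) K}
    (hg : g.1 = quaternionMatrix x y (φ / 2) 0 ((φ - 1) / 2) (1 / 2)) (m : ℕ) :
    g ∈ conjStabilizer (icosahedron x y φ) m := by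
  apply mem_conjStabilizer
  · rw [hg, quaternionMatrix_det h,
      show (φ / 2) ^ 2 + 0 ^ 2 + ((φ - 1) / 2) ^ 2 + (1 / 2) ^ 2 = 1 by
        linear_combination hφ / 2, one_pow]
  · rw [hg]
    intro i
    fin_cases i
    · refine ⟨0, Or.inl ?_⟩
      simp only [Fin.zero_eta, Matrix.cons_val, icosahedron, quaternionMatrix_mul h]
      apply quaternionMatrix_congr <;> grind
    · refine ⟨2, Or.inr ?_⟩
      simp only [Fin.mk_one, Matrix.cons_val, icosahedron, quaternionMatrix_mul h, quaternionMatrix_neg]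
      apply quaternionMatrix_congr <;> grind
    · refine ⟨4, Or.inl ?_⟩
      simp only [Fin.reduceFinMk, Matrix.cons_val, icosahedron, quaternionMatrix_mul h]
      apply quaternionMatrix_congr <;> grind
    · refine ⟨1, Or.inr ?_⟩
      simp only [Fin.reduceFinMk, Matrix.cons_val, icosahedron, quaternionMatrix_mul h, quaternionMatrix_neg]
      apply quaternionMatrix_congr <;> grind
    · refine ⟨5, Or.inr ?_⟩
      simp only [Fin.reduceFinMk, Matrix.cons_val, icosahedron, quaternionMatrix_mul h, quaternionMatrix_neg]
      apply quaternionMatrix_congr <;> grind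
    · refine ⟨3, Or.inr ?_⟩
      simp only [Fin.reduceFinMk, Matrix.cons_val, icosahedron, quaternionMatrix_mul h, quaternionMatrix_neg]
      apply quaternionMatrix_congr <;> grind

/-- A matrix commuting with two orthogonal reflections of a square is scalar. -/
theorem square_commutant [CharZero K] (M : Matrix (Fin 2) (Fin 2) K)
    (hM : ∀ i : Fin 2, M * ![!![1, 0; 0, -1], !![0, 1; 1, 0]] i =
      (![!![1, 0; 0, -1], !![0, 1; 1, 0]] i : Matrix (Fin 2) (Fin 2) K) * M) :
    IsScalarMatrix M := by
  have h0 := hM 0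
  have h1 := hM 1
  simp only [matrixTwo_eq_iff, Matrix.mul_apply, Fin.sum_univ_two] at h0 h1
  simp at h0 h1
  rw [isScalarMatrix_iff]
  obtain ⟨h2, h3⟩ := h0
  refine ⟨?_, ?_, h1.2.1⟩
  · grind
  · grind

end FiniteStabilizers

/-! ### Upper and lower bounds for the Jordan constant. -/

section JordanConstant

open Subgroup

theorem jordanConstant_eq {Γ : Type*} [Group Γ] {n : ℕ} (h : IsJordanBound Γ n)
    (hmin : ∀ m, IsJordanBound Γ m → n ≤ m) : jordanConstant Γ = n := by
  apply le_antisymm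
  · exact iInf₂_le n h
  · exact le_iInf₂ fun m hm => by exact_mod_cast hmin m hm

variable {K : Type*} [Field K] [CharZero K]

/-- The abelian normal subgroup is the whole group, a centralizer of index at most 2, or the center.
-/
theorem isJordanBound_of_center {K : Type*} [Field K] {n : ℕ} (hn : 2 ≤ n)
    (h : ∀ H : Subgroup (Matrix.GeneralLinearGroup (Fin 2) K), Finite H →
      (¬ ∀ a b : H, Commute a b) → (¬ ∃ T : NoncentralCentralizer H, T.1.index ≤ 2) →
        (center H).index ≤ n) :
    IsJordanBound (Matrix.GeneralLinearGroup (Fin 2) K) n := by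
  intro H hH
  by_cases hc : ∀ a b : H, Commute a b
  · refine ⟨⊤, inferInstance, fun a _ b _ => hc a b, ?_⟩
    rw [index_top]
    omega
  · by_cases hT : ∃ T : NoncentralCentralizer H, T.1.index ≤ 2
    · obtain ⟨T, hT⟩ := hT
      refine ⟨T.1, ?_, fun a ha b hb => NoncentralCentralizer.commute_of_mem
        (centralizersAbelian_of_injective H.subtype_injective hc) ha hb, hT.trans hn⟩
      have h0 : T.1.index ≠ 0 := index_ne_zero_of_finite
      obtain h1 | h2 : T.1.index = 1 ∨ T.1.index = 2 := by omega
      · rw [index_eq_one] at h1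
        rw [h1]
        infer_instance
      · exact normal_of_index_eq_two h2
    · exact ⟨center H, inferInstance, fun a ha b _ => (mem_center_iff.mp ha b).symm,
        h H hH hc hT⟩

theorem isJordanBound_sixty : IsJordanBound (Matrix.GeneralLinearGroup (Fin 2) K) 60 := by
  refine isJordanBound_of_center (by norm_num) fun H _ hc hT => ?_
  rcases (finite_linear_group_cases H.subtype_injective hc).resolve_left hT with
    ⟨_, h | h | h⟩ <;> omega

theorem isJordanBound_twentyFour (h5 : ¬ ∃ s : K, s ^ 2 = 5) :
    IsJordanBound (Matrix.GeneralLinearGroup (Fin 2) K) 24 := by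
  refine isJordanBound_of_center (by norm_num) fun H _ hc hT => ?_
  rcases (finite_linear_group_cases H.subtype_injective hc).resolve_left hT with
    ⟨_, h | h | h⟩
  · omega
  · omega
  · exact absurd h.2 h5

theorem isJordanBound_twelve (h5 : ¬ ∃ s : K, s ^ 2 = 5)
    (hζ : ∀ ζ : K, ¬ IsRootOfUnity (2 * ζ ^ 2)) :
    IsJordanBound (Matrix.GeneralLinearGroup (Fin 2) K) 12 := by
  refine isJordanBound_of_center (by norm_num) fun H _ hc hT => ?_
  rcases (finite_linear_group_cases H.subtype_injective hc).resolve_left hT with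
    ⟨_, h | ⟨_, ζ, h⟩ | h⟩
  · omega
  · exact absurd h (hζ ζ)
  · exact absurd h.2 h5

theorem isJordanBound_two (hK : ¬ NegOneIsSumOfTwoSquares K) :
    IsJordanBound (Matrix.GeneralLinearGroup (Fin 2) K) 2 := by
  refine isJordanBound_of_center le_rfl fun H _ hc hT => ?_
  exact absurd ((finite_linear_group_cases H.subtype_injective hc).resolve_left hT).1 hK

/-- A finite subgroup with two non-commuting elements of order three bounds the Jordan constant
from below by the order of its quotient by its center. -/
theorem index_center_le_of_isJordanBound {H : Subgroup (Matrix.GeneralLinearGroup (Fin 2) K)}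
    [Finite H] {a b : H} (ha : a ^ 3 = 1) (hb : b ^ 3 = 1) (hab : ¬ Commute a b) :
    (∀ m, IsJordanBound (Matrix.GeneralLinearGroup (Fin 2) K) m → (center H).index ≤ m) ∧
    (((center H).index = 12 ∧ ∀ g : H, g ^ 4 ∈ center H → g ^ 2 ∈ center H) ∨
      (center H).index = 24 ∨ (center H).index = 60) := by
  have hc : ¬ ∀ a b : H, Commute a b := fun h => hab (h a b)
  have hAC := centralizersAbelian_of_injective H.subtype_injective hc
  have hN := centralizersIndexTwo_of_injective H.subtype_injective hc
  have hT : ¬ ∃ T : NoncentralCentralizer H, T.1.index ≤ 2 := by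
    rintro ⟨T, hT⟩
    have hmem : ∀ c : H, c ^ 3 = 1 → c ∈ T.1 := by
      intro c hc
      have h0 : T.1.index ≠ 0 := index_ne_zero_of_finite
      obtain h1 | h2 : T.1.index = 1 ∨ T.1.index = 2 := by omega
      · rw [index_eq_one] at h1
        rw [h1]
        exact mem_top c
      -- An element of order dividing 3 is a square, `c = (c²)²`, so it lies in every subgroup of
      -- index 2.
      · have h3 := pow_mem (sq_mem_of_index_two h2 c) 2
        rwa [← pow_mul, show 2 * 2 = 3 + 1 from rfl, pow_succ, hc, one_mul] at h3
    exact hab (NoncentralCentralizer.commute_of_mem hAC (hmem a ha) (hmem b hb))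
  refine ⟨fun m hm => ?_, ?_⟩
  · obtain ⟨A, hA, hAcomm, hAm⟩ := hm H inferInstance
    have hle : A ≤ center H := by
      by_contra hle
      exact hT (NoncentralCentralizer.exists_index_le_two hAC hN hAcomm hle)
    exact (Nat.le_of_dvd (Nat.pos_of_ne_zero index_ne_zero_of_finite)
      (index_dvd_of_le hle)).trans hAm
  · rcases (finite_linear_group_cases H.subtype_injective hc).resolve_left hT with
      ⟨_, h | h | h⟩
    · exact Or.inl h
    · exact Or.inr (Or.inl h.1)
    · exact Or.inr (Or.inr h.1)

/-- The two anticommuting reflections lie in a finite subgroup, which is therefore non-abelian, over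
any `K`. -/
theorem two_le_of_isJordanBound {m : ℕ}
    (hm : IsJordanBound (Matrix.GeneralLinearGroup (Fin 2) K) m) : 2 ≤ m := by
  let v : Fin 2 → Matrix (Fin 2) (Fin 2) K := ![!![1, 0; 0, -1], !![0, 1; 1, 0]]
  have hd : ∀ i, (v i).det = -1 := by
    intro i
    fin_cases i <;> simp [v]
  let g : Fin 2 → Matrix.GeneralLinearGroup (Fin 2) K := fun i =>
    Matrix.GeneralLinearGroup.mkOfDetNeZero (v i) (by rw [hd]; simp)
  have hanti : v 0 * v 1 = -v 1 * v 0 := by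
    simp [v]
  have hg : ∀ i, g i ∈ conjStabilizer v 2 := by
    intro i
    apply mem_conjStabilizer
    · change (v i).det ^ 2 = 1
      rw [hd]
      norm_num
    · intro j
      refine ⟨j, ?_⟩
      change v i * v j = v j * v i ∨ v i * v j = -v j * v i
      fin_cases i <;> fin_cases j
      · exact Or.inl rfl
      · exact Or.inr hanti
      · right
        change v 1 * v 0 = -v 0 * v 1
        rw [neg_mul, hanti, neg_mul, neg_neg]
      · exact Or.inl rfl
  have hfin : Finite (conjStabilizer v 2) := conjStabilizer_finite v two_pos square_commutant
  obtain ⟨A, _, hA, hAm⟩ := hm (conjStabilizer v 2) hfin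
  have h0 : A.index ≠ 0 := index_ne_zero_of_finite
  have h1 : A.index ≠ 1 := by
    intro h1
    rw [index_eq_one] at h1
    have := hA ⟨g 0, hg 0⟩ (h1 ▸ mem_top _) ⟨g 1, hg 1⟩ (h1 ▸ mem_top _)
    have h2 : v 0 * v 1 = v 1 * v 0 :=
      congrArg (fun h : conjStabilizer v 2 => (h.1.1 : Matrix (Fin 2) (Fin 2) K)) this
    have h3 := congrFun (congrFun h2 0) 1
    simp only [v, Matrix.mul_apply, Fin.sum_univ_two] at h3
    simp at h3
    have h4 : (2 : K) = 0 := by linear_combination h3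
    exact two_ne_zero h4
  omega

section Quaternion

variable {x y : K}

/-- The invertible matrices `(-1 + i + ε j + ε k) / 2`. -/
noncomputable def orderThreeElement (h : (-1 : K) = x ^ 2 + y ^ 2) {ε : K}
    (hε : ε = 1 ∨ ε = -1) : Matrix.GeneralLinearGroup (Fin 2) K :=
  Matrix.GeneralLinearGroup.mkOfDetNeZero
    (quaternionMatrix x y (-1 / 2) (1 / 2) (ε / 2) (ε / 2)) (by
      rw [quaternionMatrix_det h]
      rcases hε with rfl | rfl <;> norm_num)

theorem orderThreeElement_pow (h : (-1 : K) = x ^ 2 + y ^ 2) {ε : K} (hε : ε = 1 ∨ ε = -1) :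
    orderThreeElement h hε ^ 3 = 1 := by
  apply Units.ext
  rw [Units.val_pow_eq_pow_val, pow_succ, pow_two]
  change quaternionMatrix x y _ _ _ _ * quaternionMatrix x y _ _ _ _ *
    quaternionMatrix x y _ _ _ _ = 1
  have h1 : (1 : Matrix (Fin 2) (Fin 2) K) = quaternionMatrix x y 1 0 0 0 := by
    simp [quaternionMatrix, Matrix.one_fin_two]
  rw [quaternionMatrix_mul h, quaternionMatrix_mul h, h1]
  rcases hε with rfl | rfl <;> apply quaternionMatrix_congr <;> norm_num

theorem not_commute_orderThreeElement (h : (-1 : K) = x ^ 2 + y ^ 2) :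
    ¬ Commute (orderThreeElement h (Or.inl rfl)) (orderThreeElement h (Or.inr rfl)) := by
  intro hc
  have h1 : quaternionMatrix x y _ _ _ _ * quaternionMatrix x y _ _ _ _ =
    quaternionMatrix x y _ _ _ _ * quaternionMatrix x y _ _ _ _ := congrArg Units.val hc
  rw [quaternionMatrix_mul h, quaternionMatrix_mul h] at h1
  have h2 : IsScalarMatrix (quaternionMatrix x y 0 0 1 (-1)) := by
    refine ⟨0, ?_⟩
    rw [zero_smul, ← sub_eq_zero.mpr h1, sub_eq_add_neg, quaternionMatrix_neg,
      quaternionMatrix_add]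
    apply quaternionMatrix_congr <;> norm_num
  rw [quaternionMatrix_isScalarMatrix_iff h] at h2
  exact one_ne_zero h2.2.1

/-- The lower bound of `index_center_le_of_isJordanBound` for a subgroup containing the standard
elements of order three. -/
theorem index_center_le_of_orderThreeElement_mem (h : (-1 : K) = x ^ 2 + y ^ 2)
    {H : Subgroup (Matrix.GeneralLinearGroup (Fin 2) K)} [Finite H]
    (hH : ∀ {ε : K} (hε : ε = 1 ∨ ε = -1), orderThreeElement h hε ∈ H) :
    (¬ ∀ a b : H, Commute a b) ∧
    (∀ m, IsJordanBound (Matrix.GeneralLinearGroup (Fin 2) K) m → (center H).index ≤ m) ∧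
    (((center H).index = 12 ∧ ∀ g : H, g ^ 4 ∈ center H → g ^ 2 ∈ center H) ∨
      (center H).index = 24 ∨ (center H).index = 60) := by
  obtain ⟨a, ha⟩ : ∃ a : H, a.1 = orderThreeElement h (Or.inl rfl) := ⟨⟨_, hH (Or.inl rfl)⟩, rfl⟩
  obtain ⟨b, hb⟩ : ∃ b : H, b.1 = orderThreeElement h (Or.inr rfl) := ⟨⟨_, hH (Or.inr rfl)⟩, rfl⟩
  have ha3 : a ^ 3 = 1 := by
    rw [Subtype.ext_iff, SubmonoidClass.coe_pow, ha, orderThreeElement_pow, OneMemClass.coe_one]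
  have hb3 : b ^ 3 = 1 := by
    rw [Subtype.ext_iff, SubmonoidClass.coe_pow, hb, orderThreeElement_pow, OneMemClass.coe_one]
  have hab : ¬ Commute a b := by
    intro hc
    have := hc.map H.subtype
    rw [subtype_apply, subtype_apply, ha, hb] at this
    exact not_commute_orderThreeElement h this
  exact ⟨fun h => hab (h _ _), index_center_le_of_isJordanBound ha3 hb3 hab⟩

theorem twelve_le_of_isJordanBound (hK : NegOneIsSumOfTwoSquares K) {m : ℕ}
    (hm : IsJordanBound (Matrix.GeneralLinearGroup (Fin 2) K) m) : 12 ≤ m := by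
  obtain ⟨x, y, h⟩ := hK
  have := conjStabilizer_finite (octahedron x y) one_pos (octahedron_commutant h)
  obtain ⟨_, h1, h2⟩ := index_center_le_of_orderThreeElement_mem h
    (H := conjStabilizer (octahedron x y) 1) fun hε => octahedron_three_mem h hε rfl 1
  have := h1 m hm
  omega

theorem twentyFour_le_of_isJordanBound (hK : NegOneIsSumOfTwoSquares K) {ζ : K}
    (hζ : IsRootOfUnity (2 * ζ ^ 2)) {m : ℕ}
    (hm : IsJordanBound (Matrix.GeneralLinearGroup (Fin 2) K) m) : 24 ≤ m := by
  obtain ⟨x, y, h⟩ := hK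
  obtain ⟨k, hk, hζ⟩ := hζ
  have := conjStabilizer_finite (octahedron x y) hk (octahedron_commutant h)
  obtain ⟨hc, h1, h2⟩ := index_center_le_of_orderThreeElement_mem h
    (H := conjStabilizer (octahedron x y) k) fun hε => octahedron_three_mem h hε rfl k
  have := h1 m hm
  have hζ0 : ζ ≠ 0 := by
    rintro rfl
    simp [hk.ne'] at hζ
  let g : Matrix.GeneralLinearGroup (Fin 2) K :=
    Matrix.GeneralLinearGroup.mkOfDetNeZero (quaternionMatrix x y ζ ζ 0 0) (by
      rw [quaternionMatrix_det h,
        show ζ ^ 2 + ζ ^ 2 + 0 ^ 2 + 0 ^ 2 = 2 * ζ ^ 2 by ring]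
      exact mul_ne_zero two_ne_zero (pow_ne_zero 2 hζ0))
  let g' : conjStabilizer (octahedron x y) k := ⟨g, octahedron_four_mem h hζ rfl⟩
  have hg2 : (g ^ 2).1 = quaternionMatrix x y 0 (2 * ζ ^ 2) 0 0 := by
    rw [Units.val_pow_eq_pow_val, pow_two]
    change quaternionMatrix x y _ _ _ _ * quaternionMatrix x y _ _ _ _ = _
    rw [quaternionMatrix_mul h]
    apply quaternionMatrix_congr <;> ring
  have hg4 : (g ^ 4).1 = quaternionMatrix x y (-(2 * ζ ^ 2) ^ 2) 0 0 0 := by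
    rw [show 4 = 2 * 2 from rfl, pow_mul, pow_two (g ^ 2), Units.val_mul, hg2,
      quaternionMatrix_mul h]
    apply quaternionMatrix_congr <;> ring
  -- Index 12 is excluded because `g⁴` is scalar while `g²` is not.
  rcases h2 with ⟨_, h2⟩ | h2 | h2
  · exfalso
    have h3 := h2 g'
    rw [mem_center_iff_isScalarMatrix (subtype_injective _) hc,
      mem_center_iff_isScalarMatrix (subtype_injective _) hc, map_pow, map_pow] at h3
    change IsScalarMatrix (g ^ 4).1 → IsScalarMatrix (g ^ 2).1 at h3
    rw [hg2, hg4, quaternionMatrix_isScalarMatrix_iff h,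
      quaternionMatrix_isScalarMatrix_iff h] at h3
    have := (h3 ⟨rfl, rfl, rfl⟩).1
    simp [hζ0] at this
  · omega
  · omega

theorem sixty_le_of_isJordanBound (hK : NegOneIsSumOfTwoSquares K) {s : K} (hs : s ^ 2 = 5)
    {m : ℕ} (hm : IsJordanBound (Matrix.GeneralLinearGroup (Fin 2) K) m) : 60 ≤ m := by
  obtain ⟨x, y, h⟩ := hK
  obtain ⟨φ, hφ⟩ : ∃ φ : K, φ ^ 2 = φ + 1 := ⟨(1 + s) / 2, by linear_combination hs / 4⟩
  have := conjStabilizer_finite (icosahedron x y φ) one_pos (icosahedron_commutant h φ)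
  obtain ⟨hc, h1, h2⟩ := index_center_le_of_orderThreeElement_mem h
    (H := conjStabilizer (icosahedron x y φ) 1) fun hε => icosahedron_three_mem h φ hε rfl 1
  have := h1 m hm
  let g : Matrix.GeneralLinearGroup (Fin 2) K :=
    Matrix.GeneralLinearGroup.mkOfDetNeZero
      (quaternionMatrix x y (φ / 2) 0 ((φ - 1) / 2) (1 / 2)) (by
      rw [quaternionMatrix_det h,
        show (φ / 2) ^ 2 + 0 ^ 2 + ((φ - 1) / 2) ^ 2 + (1 / 2) ^ 2 = 1 by
          linear_combination hφ / 2]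
      exact one_ne_zero)
  let g' : conjStabilizer (icosahedron x y φ) 1 := ⟨g, icosahedron_five_mem h hφ rfl 1⟩
  have hg1 : g' ∉ center (conjStabilizer (icosahedron x y φ) 1) := by
    rw [mem_center_iff_isScalarMatrix (subtype_injective _) hc]
    change ¬ IsScalarMatrix (quaternionMatrix x y _ _ _ _)
    rw [quaternionMatrix_isScalarMatrix_iff h]
    simp
  have hg2 : (g ^ 2).1 = quaternionMatrix x y ((φ - 1) / 2) 0 (1 / 2) (φ / 2) := by
    rw [Units.val_pow_eq_pow_val, pow_two]
    change quaternionMatrix x y _ _ _ _ * quaternionMatrix x y _ _ _ _ = _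
    rw [quaternionMatrix_mul h]
    apply quaternionMatrix_congr <;> grind
  have hg5 : (g ^ 5).1 = quaternionMatrix x y (-1) 0 0 0 := by
    rw [show 5 = 2 + 2 + 1 from rfl, pow_succ, pow_add, Units.val_mul, Units.val_mul, hg2]
    change quaternionMatrix x y _ _ _ _ * quaternionMatrix x y _ _ _ _ *
      quaternionMatrix x y _ _ _ _ = _
    rw [quaternionMatrix_mul h, quaternionMatrix_mul h]
    apply quaternionMatrix_congr <;> grind
  have hg5' : g' ^ 5 ∈ center (conjStabilizer (icosahedron x y φ) 1) := by
    rw [mem_center_iff_isScalarMatrix (subtype_injective _) hc, map_pow]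
    change IsScalarMatrix (g ^ 5).1
    rw [hg5, quaternionMatrix_isScalarMatrix_iff h]
    simp
  -- An index dividing 24 would make `g²⁴` central; as `g²⁵` is central, so would be `g`. This
  -- leaves only 60.
  have hndvd : ¬ (center (conjStabilizer (icosahedron x y φ) 1)).index ∣ 24 := by
    rintro ⟨k, hk⟩
    have h3 : g' ^ 24 ∈ center (conjStabilizer (icosahedron x y φ) 1) := by
      rw [hk, pow_mul]
      exact pow_mem (pow_index_mem _ g') k
    have h4 := pow_mem hg5' 5
    rw [← pow_mul, show 5 * 5 = 24 + 1 from rfl, pow_succ] at h4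
    exact hg1 ((mul_mem_cancel_left h3).mp h4)
  rcases h2 with ⟨h2, _⟩ | h2 | h2
  · rw [h2] at hndvd
    exact absurd (by decide) hndvd
  · rw [h2] at hndvd
    exact absurd (by decide) hndvd
  · omega

end Quaternion

end JordanConstant

theorem theorem1p3 (K : Type*) [Field K] [CharZero K] :
    jordanConstant (Matrix.GeneralLinearGroup (Fin 2) K) ∈ ({60, 24, 12, 2} : Set ℕ∞) ∧
    (jordanConstant (Matrix.GeneralLinearGroup (Fin 2) K) = 60 ↔
      NegOneIsSumOfTwoSquares K ∧ ∃ s : K, s ^ 2 = 5) ∧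
    (jordanConstant (Matrix.GeneralLinearGroup (Fin 2) K) = 24 ↔
      NegOneIsSumOfTwoSquares K ∧ (¬ ∃ s : K, s ^ 2 = 5) ∧
        ∃ ζ : K, IsRootOfUnity (2 * ζ ^ 2)) ∧
    (jordanConstant (Matrix.GeneralLinearGroup (Fin 2) K) = 12 ↔
      NegOneIsSumOfTwoSquares K ∧ (¬ ∃ s : K, s ^ 2 = 5) ∧
        ∀ ζ : K, ¬ IsRootOfUnity (2 * ζ ^ 2)) ∧
    (jordanConstant (Matrix.GeneralLinearGroup (Fin 2) K) = 2 ↔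
      ¬ NegOneIsSumOfTwoSquares K) := by
  by_cases hK : NegOneIsSumOfTwoSquares K
  · by_cases h5 : ∃ s : K, s ^ 2 = 5
    · obtain ⟨s, hs⟩ := h5
      have hJ := jordanConstant_eq (isJordanBound_sixty (K := K))
        fun m hm => sixty_le_of_isJordanBound hK hs hm
      have h5 : ∃ s : K, s ^ 2 = 5 := ⟨s, hs⟩
      simp [hJ, hK, h5]
    · by_cases hζ : ∃ ζ : K, IsRootOfUnity (2 * ζ ^ 2)
      · obtain ⟨ζ, hζ⟩ := hζ
        have hJ := jordanConstant_eq (isJordanBound_twentyFour h5)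
          fun m hm => twentyFour_le_of_isJordanBound hK hζ hm
        have hζ : ∃ ζ : K, IsRootOfUnity (2 * ζ ^ 2) := ⟨ζ, hζ⟩
        have hζ' : ¬ ∀ ζ : K, ¬ IsRootOfUnity (2 * ζ ^ 2) := by simpa using hζ
        rw [hJ]
        simp only [hK, h5, hζ, hζ']
        norm_num
      · have hζ' : ∀ ζ : K, ¬ IsRootOfUnity (2 * ζ ^ 2) := fun ζ h => hζ ⟨ζ, h⟩
        have hJ := jordanConstant_eq (isJordanBound_twelve h5 hζ')
          fun m hm => twelve_le_of_isJordanBound hK hm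
        rw [hJ]
        simp only [hK, h5, hζ]
        simp [hζ']
  · have hJ := jordanConstant_eq (isJordanBound_two hK)
      fun m hm => two_le_of_isJordanBound hm
    rw [hJ]
    simp [hK]
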